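/- **Setting.** Let $S$ be a finite set with at least three elements, $\Sigma=2^S$, $\Omega=S^{\infty}$ with elements $\omega=(s_1,s_2,\dots)$, $\mathcal G_t$ the (finite) $\sigma$-algebra generated by the first $t$ coordinates ($\mathcal G_0$ trivial), and $\mathcal G=\sigma(\bigcup_t\mathcal G_t)$. Let $C$ be a compact metrizable space with at least two elements and $X$ the set of Borel probability measures on $C$ with the weak topology. $\mathbf H$ is the set of $X$-valued $(\mathcal G_t)$-adapted processes $h=(h_t)_{t\ge0}$ with the topology of pointwise convergence; $\mathbf D=X^\infty\subseteq\mathbf H$ is the set of deterministic plans, and $x\in X$ is identified with the constant plan. For $s\in S$, $h\in\mathbf H$, $x\in X$: the conditional plan is $h^s(s_1,s_2,\dots)=h(s,s_2,s_3,\dots)$; the continuation $h^{s,1}\in\mathbf H$ is $(h^{s,1})_t(s_1,s_2,\dots)=h_{t+1}(s,s_1,s_2,\dots)$; the concatenation $(x,h)$ is $(x,h)_0=x$, $(x,h)_{t+1}(s_1,s_2,\dots)=h_t(s_2,s_3,\dots)$, so that $(x,h)^{s,1}=h$. For a function $\xi$ on $\Omega$ put $\xi^{s,1}(s_1,s_2,s_3,\dots)=\xi(s,s_2,s_3,\dots)$.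 Write $h^1$ for $s\mapsto h^{s,1}$. For $K\subseteq\mathbb R$, $B(K,Y,\mathcal A)$ is the set of bounded $\mathcal A$-measurable functions $Y\to K$. A functional $I:B(K,Y,\mathcal A)\to\mathbb R$ is a *certainty equivalent* if it is monotone, normalized ($I(k)=k$ for constants $k\in K$), and $I(\xi_n)\to I(\xi)$ whenever $\xi_n\to\xi$ pointwise; it is *translation invariant* if $I(\xi+k)=I(\xi)+k$ whenever $k\in\mathbb R$ and $\xi,\xi+k$ are in the domain. For $u:X\to\mathbb R$ continuous and $\beta\in(0,1)$, $U(d)=\sum_{t\ge0}\beta^tu(d_t)$ for $d\in\mathbf D$, and $U(h)$ denotes the random variable $\omega\mapsto\sum_{t\ge0}\beta^tu(h_t(\omega))$ for $h\in\mathbf H$. **Axioms** on a binary relation $\succsim$ on $\mathbf H$. *Weak order*: complete and transitive. *Continuity*: $\{h:h\succsim g\}$ and $\{h:g\succsim h\}$ are closed for all $g$. *Nontriviality*: $x\succ y$ for some $x,y\in X$. *Time separability*: for $x,y,x',y'\in X$, $d,d'\in\mathbf D$, $(x,y,d)\sim(x',y',d)$ iff $(x,y,d')\sim(x',y',d')$.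 *Stationarity*: $h\succsim g$ iff $(x,h)\succsim(x,g)$, for all $x\in X$, $h,g\in\mathbf H$. *Independence*: for $d,d',d''\in\mathbf D$, $\alpha\in(0,1)$, $d\sim d'$ implies $\alpha d+(1-\alpha)d''\sim\alpha d'+(1-\alpha)d''$. *Dynamic consistency*: if $h_0=g_0$ and $h^s\succsim g^s$ for all $s\in S$, then $h\succsim g$. *State monotonicity*: if for every $\omega$ the deterministic plan $(h_t(\omega))_t$ is weakly preferred to $(g_t(\omega))_t$, then $h\succsim g$. **Theorem.** For a binary relation $\succsim$ on $\mathbf H$ the following are equivalent. (i) $\succsim$ satisfies the eight axioms. (ii) There are $V:\mathbf H\to\mathbb R$, a continuous, affine, non-constant $u:X\to\mathbb R$, $\beta\in(0,1)$, and translation invariant certainty equivalents $I_{+1}:B(U(\mathbf D),S,\Sigma)\to\mathbb R$ and $I_0:B(U(\mathbf D),\Omega,\mathcal G)\to\mathbb R$ such that $V$ represents $\succsim$, and for all $h\in\mathbf H$, $V\circ h^1\in B(U(\mathbf D),S,\Sigma)$ and $V(h)=u(h_0)+\beta I_{+1}(V\circ h^1)$; and such that $h\mapsto I_0\big(\sum_{t\ge0}\beta^tu(h_t)\big)$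 also represents $\succsim$. Moreover, consider generalized rectangularity $$I_0(\xi)=\beta I_{+1}\Big(\tfrac1\beta I_0(\xi^1)\Big),\qquad I_0(\xi^1)(s)=I_0(\xi^{s,1}),\tag{GR}$$ where the right-hand side is understood through the unique translation invariant extension $I_{+1}(\varphi-k)=I_{+1}(\varphi)-k$ ($\varphi\in B(U(\mathbf D),S,\Sigma)$, $k\in\mathbb R$), and is thus defined when $\tfrac1\beta I_0(\xi^1)+k\in B(U(\mathbf D),S,\Sigma)$ for some $k\in\mathbb R$. Then, for every $(V,u,\beta,I_{+1},I_0)$ as in (ii): (a) for every $\xi=\sum_{t\ge0}\beta^tu(h_t)$ with $h\in\mathbf H$, the right-hand side of (GR) is defined and (GR) holds; (b) there is $I_0'$ such that $(V,u,\beta,I_{+1},I_0')$ is as in (ii), $I_0'=I_0$ on $\{U(h):h\in\mathbf H\}$, and (GR) holds for $I_0'$ and every $\xi\in B(U(\mathbf D),\Omega,\mathcal G)$ for which its right-hand side is defined. -/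

import Mathlib

open MeasureTheory Filter Topology

noncomputable section

namespace MonoRec

/-! ### Information and bounded measurable functions -/

/-- Full states `ω = (s₁, s₂, …)`; the coordinate `ω i` is the shock `s_{i+1}`. -/
abbrev States (S : Type*) : Type _ := ℕ → S

/-- `𝒢_t`: the information carried by the first `t` shocks (all subsets of `S^t` are events). -/
abbrev info (S : Type*) (t : ℕ) : MeasurableSpace (States S) :=
  MeasurableSpace.comap (fun (ω : States S) (i : Fin t) => ω i) ⊤

/-- `𝒢`: the σ-algebra generated by all the `𝒢_t`. -/
abbrev infoAll (S : Type*) : MeasurableSpace (States S) := ⨆ t, info S t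

/-- `B(K, Y, 𝒜)`: bounded `𝒜`-measurable functions on `Y` with values in `K`. -/
structure BFun (K : Set ℝ) (Y : Type*) (m : MeasurableSpace Y) where
  toFun : Y → ℝ
  measurable' : Measurable[m] toFun
  mem' : ∀ y, toFun y ∈ K
  bounded' : ∃ M : ℝ, ∀ y, |toFun y| ≤ M

instance (K : Set ℝ) (Y : Type*) (m : MeasurableSpace Y) :
    CoeFun (BFun K Y m) (fun _ => Y → ℝ) := ⟨BFun.toFun⟩

/-- A certainty equivalent on `B(K, Y, 𝒜)`: continuous along pointwise convergent sequences,
monotone and normalized. -/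
structure IsCertaintyEquivalent {K : Set ℝ} {Y : Type*} {m : MeasurableSpace Y}
    (I : BFun K Y m → ℝ) : Prop where
  continuous : ∀ (ξn : ℕ → BFun K Y m) (ξ : BFun K Y m),
    (∀ y, Tendsto (fun n => ξn n y) atTop (𝓝 (ξ y))) →
      Tendsto (fun n => I (ξn n)) atTop (𝓝 (I ξ))
  monotone : ∀ ξ ξ' : BFun K Y m, (∀ y, ξ' y ≤ ξ y) → I ξ' ≤ I ξ
  normalized : ∀ k ∈ K, ∀ ξ : BFun K Y m, (∀ y, ξ y = k) → I ξ = k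

/-- `I(ξ + k) = I(ξ) + k` whenever both `ξ` and `ξ + k` belong to the domain. -/
def TranslationInvariant {K : Set ℝ} {Y : Type*} {m : MeasurableSpace Y}
    (I : BFun K Y m → ℝ) : Prop :=
  ∀ (ξ η : BFun K Y m) (k : ℝ), (∀ y, η y = ξ y + k) → I η = I ξ + k

/-! ### Operations on states -/

/-- `(s₁, s₂, s₃, …) ↦ (s, s₂, s₃, …)`. -/
def setFirst {S : Type*} (s : S) (ω : States S) : States S
  | 0 => s
  | i + 1 => ω (i + 1)

/-- `(s₁, s₂, …) ↦ (s, s₁, s₂, …)`. -/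
def consState {S : Type*} (s : S) (ω : States S) : States S
  | 0 => s
  | i + 1 => ω i

/-- `(s₁, s₂, …) ↦ (s₂, s₃, …)`. -/
def shiftState {S : Type*} (ω : States S) : States S := fun i => ω (i + 1)

theorem measurable_of_factor {S : Type*} {t t' : ℕ} (f : States S → States S)
    (g : (Fin t → S) → (Fin t' → S))
    (h : ∀ ω, (fun i : Fin t' => f ω i) = g (fun i : Fin t => ω i)) :
    Measurable[info S t, info S t'] f := by
  rw [info, info, @measurable_iff_comap_le, MeasurableSpace.comap_comp]
  have : (fun (ω : States S) (i : Fin t') => ω i) ∘ f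
      = g ∘ (fun (ω : States S) (i : Fin t) => ω i) := funext h
  rw [this, ← MeasurableSpace.comap_comp]
  exact MeasurableSpace.comap_mono le_top

theorem measurable_setFirst {S : Type*} (s : S) (t : ℕ) :
    Measurable[info S t, info S t] (setFirst s) := by
  refine measurable_of_factor _ (fun p i => if (i : ℕ) = 0 then s else p i) fun ω => ?_
  funext i
  rcases i with ⟨_ | i, hi⟩ <;> simp [setFirst]

theorem measurable_consState {S : Type*} (s : S) (t : ℕ) :
    Measurable[info S t, info S (t + 1)] (consState s) := by
  refine measurable_of_factor _
    (fun p i => if h : (i : ℕ) = 0 then s else p ⟨i - 1, by omega⟩) fun ω => ?_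
  funext i
  rcases i with ⟨_ | i, hi⟩ <;> simp [consState]

theorem measurable_shiftState {S : Type*} (t : ℕ) :
    Measurable[info S (t + 1), info S t] (shiftState (S := S)) :=
  measurable_of_factor _ (fun p i => p i.succ) fun _ => rfl

theorem measurable_setFirst_all {S : Type*} (s : S) :
    Measurable[infoAll S, infoAll S] (setFirst s) := by
  rw [@measurable_iff_comap_le, infoAll, MeasurableSpace.comap_iSup]
  exact iSup_mono fun t => (@measurable_iff_comap_le _ _ _ _ _).1 (measurable_setFirst s t)

/-- `ξ^{s,1}(s₁, s₂, s₃, …) = ξ(s, s₂, s₃, …)`. -/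
def BFun.condition {S : Type*} {K : Set ℝ} (ξ : BFun K (States S) (infoAll S)) (s : S) :
    BFun K (States S) (infoAll S) where
  toFun ω := ξ (setFirst s ω)
  measurable' := by
    have := @Measurable.comp _ _ _ (infoAll S) (infoAll S) _ _ _ ξ.measurable'
      (measurable_setFirst_all s)
    exact this
  mem' ω := ξ.mem' _
  bounded' := ξ.bounded'.imp fun _ h ω => h _

/-! ### Lotteries and consumption plans -/

section Plans

variable {S C : Type*} [TopologicalSpace C] [MeasurableSpace C] [BorelSpace C]

/-- The mixture `a x + (1 - a) y` of two lotteries. -/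
def mix (a : unitInterval) (x y : ProbabilityMeasure C) : ProbabilityMeasure C :=
  ⟨ENNReal.ofReal (a : ℝ) • (x : Measure C) + ENNReal.ofReal (1 - (a : ℝ)) • (y : Measure C), by
    constructor
    simp only [Measure.coe_add, Measure.coe_smul, Pi.add_apply, Pi.smul_apply, measure_univ,
      smul_eq_mul, mul_one]
    rw [← ENNReal.ofReal_add a.2.1 (by linarith [a.2.2])]
    simp⟩

/-- `u(a x + (1 - a) y) = a u(x) + (1 - a) u(y)`. -/
def IsAffineUtility (u : ProbabilityMeasure C → ℝ) : Prop :=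
  ∀ (a : unitInterval) (x y : ProbabilityMeasure C),
    u (mix a x y) = (a : ℝ) * u x + (1 - (a : ℝ)) * u y

variable (S C) in
/-- A consumption plan: an adapted process of lotteries. Lotteries carry the topology of weak
convergence and its Borel σ-algebra. -/
@[ext]
structure Plan where
  at' : ℕ → States S → ProbabilityMeasure C
  adapted : ∀ t, @Measurable _ _ (info S t) (borel (ProbabilityMeasure C)) (at' t)

/-- The topology of pointwise convergence on plans. -/
instance : TopologicalSpace (Plan S C) := TopologicalSpace.induced Plan.at' inferInstance

/-- A deterministic plan, seen as a plan. -/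
def Plan.det (d : ℕ → ProbabilityMeasure C) : Plan S C where
  at' t _ := d t
  adapted t := @measurable_const _ _ (borel (ProbabilityMeasure C)) (info S t) (d t)

/-- The deterministic sequence `(x, d₀, d₁, …)`. -/
def consSeq (x : ProbabilityMeasure C) (d : ℕ → ProbabilityMeasure C) :
    ℕ → ProbabilityMeasure C
  | 0 => x
  | t + 1 => d t

/-- The concatenation `(x, h)(s₁, s₂, …) = (x, h(s₂, s₃, …))`. -/
def Plan.concat (x : ProbabilityMeasure C) (h : Plan S C) : Plan S C where
  at' t ω := match t with
    | 0 => x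
    | t + 1 => h.at' t (shiftState ω)
  adapted t := by
    cases t with
    | zero => exact @measurable_const _ _ (borel (ProbabilityMeasure C)) (info S 0) x
    | succ t =>
      exact @Measurable.comp _ _ _ (info S (t + 1)) (info S t) (borel (ProbabilityMeasure C)) _ _
        (h.adapted t) (measurable_shiftState t)

/-- The conditional plan `h^s(s₁, s₂, s₃, …) = h(s, s₂, s₃, …)`. -/
def Plan.cond (h : Plan S C) (s : S) : Plan S C where
  at' t ω := h.at' t (setFirst s ω)
  adapted t := @Measurable.comp _ _ _ (info S t) (info S t) (borel (ProbabilityMeasure C)) _ _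
    (h.adapted t) (measurable_setFirst s t)

/-- The continuation `h^{s,1}`: the plan that starts one period later, once the first shock is
known to be `s`; time and shocks are renumbered, so that it is again an adapted plan. -/
def Plan.cont (h : Plan S C) (s : S) : Plan S C where
  at' t ω := h.at' (t + 1) (consState s ω)
  adapted t := @Measurable.comp _ _ _ (info S t) (info S (t + 1))
    (borel (ProbabilityMeasure C)) _ _ (h.adapted (t + 1)) (measurable_consState s t)

/-! ### Axioms -/

/-- Indifference. -/
def Indiff (R : Plan S C → Plan S C → Prop) (h g : Plan S C) : Prop := R h g ∧ R g h

/-- The eight axioms on a preference, where `R h g` means that `h` is weakly preferred to `g`. -/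
structure SatisfiesAxioms (R : Plan S C → Plan S C → Prop) : Prop where
  complete : ∀ h g, R h g ∨ R g h
  transitive : ∀ h g f, R h g → R g f → R h f
  closed_upper : ∀ g, IsClosed {h | R h g}
  closed_lower : ∀ g, IsClosed {h | R g h}
  nontrivial : ∃ x y : ProbabilityMeasure C,
    R (Plan.det fun _ => x) (Plan.det fun _ => y) ∧
      ¬ R (Plan.det fun _ => y) (Plan.det fun _ => x)
  time_separable : ∀ (x y x' y' : ProbabilityMeasure C) (d d' : ℕ → ProbabilityMeasure C),
    Indiff R (Plan.det (consSeq x (consSeq y d))) (Plan.det (consSeq x' (consSeq y' d))) ↔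
      Indiff R (Plan.det (consSeq x (consSeq y d'))) (Plan.det (consSeq x' (consSeq y' d')))
  stationary : ∀ (x : ProbabilityMeasure C) (h g : Plan S C),
    R h g ↔ R (Plan.concat x h) (Plan.concat x g)
  independence : ∀ (d d' d'' : ℕ → ProbabilityMeasure C) (a : unitInterval), 0 < a → a < 1 →
    Indiff R (Plan.det d) (Plan.det d') →
      Indiff R (Plan.det fun t => mix a (d t) (d'' t)) (Plan.det fun t => mix a (d' t) (d'' t))
  dynamically_consistent : ∀ h g : Plan S C, h.at' 0 = g.at' 0 →
    (∀ s, R (h.cond s) (g.cond s)) → R h g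
  state_monotone : ∀ h g : Plan S C,
    (∀ ω, R (Plan.det fun t => h.at' t ω) (Plan.det fun t => g.at' t ω)) → R h g

/-! ### Representations -/

/-- `W` represents the preference `R`. -/
def Represents (R : Plan S C → Plan S C → Prop) (W : Plan S C → ℝ) : Prop :=
  ∀ h g, R h g ↔ W g ≤ W h

/-- Discounted utility `U(d) = ∑ β^t u(d_t)`. -/
def discounted (u : ProbabilityMeasure C → ℝ) (β : ℝ) (d : ℕ → ProbabilityMeasure C) : ℝ :=
  ∑' t, β ^ t * u (d t)

/-- `B(U(𝐃), S, Σ)`, where `Σ` consists of all subsets of `S`. -/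
abbrev OneStepDomain (S : Type*) (u : ProbabilityMeasure C → ℝ) (β : ℝ) : Type _ :=
  BFun (Set.range (discounted u β)) S ⊤

/-- `B(U(𝐃), Ω, 𝒢)`. -/
abbrev ExAnteDomain (S : Type*) (u : ProbabilityMeasure C → ℝ) (β : ℝ) : Type _ :=
  BFun (Set.range (discounted u β)) (States S) (infoAll S)

/-- `ξ` is the lifetime utility `ω ↦ ∑ β^t u(h_t(ω))` of the plan `h`. -/
def IsLifetimeUtility {u : ProbabilityMeasure C → ℝ} {β : ℝ} (ξ : ExAnteDomain S u β)
    (h : Plan S C) : Prop :=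
  ∀ ω, ξ ω = discounted u β (fun t => h.at' t ω)

/-- `(V, I₁, u, β)` is a separable recursive representation of `R`. The clause `recursive` includes
that `V ∘ h¹` lies in the domain of `I₁`. -/
structure IsSeparableRecursive (R : Plan S C → Plan S C → Prop) (V : Plan S C → ℝ)
    (u : ProbabilityMeasure C → ℝ) (β : ℝ) (I₁ : OneStepDomain S u β → ℝ) : Prop where
  represents : Represents R V
  continuous_u : Continuous u
  discount : 0 < β ∧ β < 1
  certaintyEquivalent : IsCertaintyEquivalent I₁
  recursive : ∀ h : Plan S C, ∃ φ : OneStepDomain S u β,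
    (∀ s, φ s = V (h.cont s)) ∧ ∀ ω, V h = u (h.at' 0 ω) + β * I₁ φ

/-- The preference `R` is represented by `h ↦ I₀(∑ β^t u(h_t))`. -/
def IsExAnte (R : Plan S C → Plan S C → Prop) (u : ProbabilityMeasure C → ℝ) (β : ℝ)
    (I₀ : ExAnteDomain S u β → ℝ) : Prop :=
  ∃ W : Plan S C → ℝ, Represents R W ∧
    ∀ h, ∃ ξ : ExAnteDomain S u β, IsLifetimeUtility ξ h ∧ W h = I₀ ξ

/-- Both representations, with the same `u` (affine, non-constant) and the same `β`, and with
translation invariant certainty equivalents. -/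
structure IsTwofoldRepresentation (R : Plan S C → Plan S C → Prop) (V : Plan S C → ℝ)
    (u : ProbabilityMeasure C → ℝ) (β : ℝ) (I₁ : OneStepDomain S u β → ℝ)
    (I₀ : ExAnteDomain S u β → ℝ) : Prop where
  recursive : IsSeparableRecursive R V u β I₁
  affine_u : IsAffineUtility u
  nonconstant_u : ∃ x y, u x ≠ u y
  translation₁ : TranslationInvariant I₁
  certaintyEquivalent₀ : IsCertaintyEquivalent I₀
  translation₀ : TranslationInvariant I₀
  exAnte : IsExAnte R u β I₀

/-- `φ = β⁻¹ I₀(ξ¹) + k`, as an element of the domain of the one-step-ahead functional. -/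
def IsTranslatedContinuation {u : ProbabilityMeasure C → ℝ} {β : ℝ}
    (I₀ : ExAnteDomain S u β → ℝ) (ξ : ExAnteDomain S u β) (k : ℝ)
    (φ : OneStepDomain S u β) : Prop :=
  ∀ s, φ s = (1 / β) * I₀ (ξ.condition s) + k

/-- Generalized rectangularity `I₀(ξ) = β I₁(β⁻¹ I₀(ξ¹))` at `ξ`. The right-hand side is read with
`I₁(φ - k) = I₁(φ) - k`, the only translation invariant extension of `I₁` to functions that have a
translate in its domain; `k = 0` is the equation as it stands. -/
def GeneralizedRectangularityAt {u : ProbabilityMeasure C → ℝ} {β : ℝ}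
    (I₁ : OneStepDomain S u β → ℝ) (I₀ : ExAnteDomain S u β → ℝ)
    (ξ : ExAnteDomain S u β) : Prop :=
  ∀ (k : ℝ) (φ : OneStepDomain S u β), IsTranslatedContinuation I₀ ξ k φ →
    I₀ ξ = β * (I₁ φ - k)

end Plans

end MonoRec

end

noncomputable section
namespace MonoRec

/-! Both representations come from one functional. As `u` is continuous and affine, the values of
discounted utility form a compact interval, and a translation invariant certainty equivalent `I₁`
over it extends to a monotone, translation invariant `A` on all of `ℝ^S` (`exists_aggregator`).
Apply `A` to a function `ξ` on `Ω` shock by shock, at scale `β^n` for the `n`-th shock, i.e. as `β^n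
A(·/β^n)`, with the unresolved shocks frozen. `A` is nonexpansive and stays within a fixed distance
of the evaluation at one state, so resolving one more shock moves the result by a term of order
`β^n`. The limit `limAgg` therefore exists with an error uniform in `ξ`; it is monotone, normalized,
translation invariant and pointwise continuous, and it is rectangular because fixing the first shock
makes the first aggregation trivial.

From (ii) to (i): on lifetime utilities `limAgg` obeys the same `β`-contractive recursion as `V`,
hence equals `V` (`limAgg_eq_value`). So `V` is continuous and monotone state by state, and the
axioms can be read off. Any other ex ante functional also equals `V` there, because each plan is
indifferent to a deterministic one, where normalization fixes the value (`exAnte_eq`). This yields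
(a), and (b) with `limAgg` as `I₀'`.

From (i) to (ii): compactness provides a best and a worst deterministic plan, independence and
continuity order the segment between them strictly (`not_rel_of_lt_of_independence`), and each plan
is valued by the point of the segment indifferent to it. This value is affine on deterministic
plans, and stationarity turns it into `V(x, h) = u(x) + β V(h)` (`exists_utility`). Dynamic
consistency makes `V(h)` a function of `h₀` and the continuation values; state monotonicity lets
utility be traded between dates, which splits off `u(h₀)` and makes the remainder translation
invariant (`exists_recursive`). -/

theorem BFun.ext_fun {K : Set ℝ} {Y : Type*} {m : MeasurableSpace Y} {f g : BFun K Y m}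
    (h : ∀ y, f y = g y) : f = g := by
  cases f; cases g
  congr
  exact funext h

/-- A real function on a finite set, as an element of `B(K, S, Σ)`. -/
def BFun.ofFinite {K : Set ℝ} {S : Type*} [Finite S] (φ : S → ℝ) (h : ∀ s, φ s ∈ K) :
    BFun K S ⊤ where
  toFun := φ
  measurable' := measurable_from_top
  mem' := h
  bounded' := by
    obtain ⟨M, hM⟩ := (Set.finite_range fun s => |φ s|).bddAbove
    exact ⟨M, fun s => hM ⟨s, rfl⟩⟩

/-! ### Translation invariant certainty equivalents on a finite state space -/

section Lipschitz

variable {S : Type*} [Finite S] {m M : ℝ} {I : BFun (Set.Icc m M) S ⊤ → ℝ}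

theorem IsCertaintyEquivalent.mem_Icc (hI : IsCertaintyEquivalent I) (hm : m ≤ M)
    (x : BFun (Set.Icc m M) S ⊤) : I x ∈ Set.Icc m M := by
  let l : BFun (Set.Icc m M) S ⊤ := BFun.ofFinite (fun _ => m) fun _ => ⟨le_rfl, hm⟩
  let r : BFun (Set.Icc m M) S ⊤ := BFun.ofFinite (fun _ => M) fun _ => ⟨hm, le_rfl⟩
  have hl := hI.monotone x l fun s => (x.mem' s).1
  have hr := hI.monotone r x fun s => (x.mem' s).2
  rw [hI.normalized m ⟨le_rfl, hm⟩ l fun _ => rfl] at hl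
  rw [hI.normalized M ⟨hm, le_rfl⟩ r fun _ => rfl] at hr
  exact ⟨hl, hr⟩

/-- Monotonicity and translation invariance combine to a Lipschitz bound. The care needed is that
translates must remain in `[m, M]`. -/
theorem IsCertaintyEquivalent.le_add [Nonempty S] (hI : IsCertaintyEquivalent I)
    (hT : TranslationInvariant I) (hm : m ≤ M) (x y : BFun (Set.Icc m M) S ⊤) (δ : ℝ)
    (h : ∀ s, x s ≤ y s + δ) : I x ≤ I y + δ := by
  rcases le_or_gt δ 0 with hδ | hδ
  · let z : BFun (Set.Icc m M) S ⊤ := BFun.ofFinite (fun s => x s + -δ) fun s =>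
      ⟨by linarith [(x.mem' s).1], by linarith [(y.mem' s).2, h s]⟩
    have h1 := hT x z (-δ) fun _ => rfl
    have h2 := hI.monotone y z fun s => by
      change x s + -δ ≤ y s
      linarith [h s]
    linarith
  · rcases le_or_gt δ (M - m) with hδ' | hδ'
    -- Adding `δ` to `y` may leave the interval, so `y` is first cut at `M - δ`; the shifted cut
    -- still dominates `x`, because `x ≤ M`.
    · let z : BFun (Set.Icc m M) S ⊤ := BFun.ofFinite (fun s => min (y s) (M - δ)) fun s =>
        ⟨le_min (y.mem' s).1 (by linarith), (min_le_left _ _).trans (y.mem' s).2⟩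
      let z' : BFun (Set.Icc m M) S ⊤ := BFun.ofFinite (fun s => z s + δ) fun s =>
        ⟨by linarith [(z.mem' s).1], by
          have : z s ≤ M - δ := min_le_right _ _
          linarith⟩
      have h1 := hT z z' δ fun _ => rfl
      have h2 := hI.monotone y z fun s => min_le_left _ _
      have h3 := hI.monotone z' x fun s => by
        change x s ≤ min (y s) (M - δ) + δ
        rw [← min_add_add_right]
        exact le_min (h s) (by linarith [(x.mem' s).2])
      linarith
    · linarith [(hI.mem_Icc hm x).2, (hI.mem_Icc hm y).1]

end Lipschitz

/-- A monotone, translation invariant and normalized functional on `ℝ^S` that stays within `N` of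
the evaluation at the state `s₀`. -/
structure IsAggregator {S : Type*} (A : (S → ℝ) → ℝ) (s₀ : S) (N : ℝ) : Prop where
  mono : ∀ φ ψ : S → ℝ, (∀ s, φ s ≤ ψ s) → A φ ≤ A ψ
  add_const : ∀ (φ : S → ℝ) (c : ℝ), A (fun s => φ s + c) = A φ + c
  const : ∀ c : ℝ, A (fun _ => c) = c
  near : ∀ φ : S → ℝ, |A φ - φ s₀| ≤ N

/-- A translation invariant certainty equivalent on `[m, M]^S` extends to an aggregator. -/
theorem exists_aggregator {S : Type*} [Fintype S] (s₀ : S) {m M : ℝ} (hm : m ≤ M)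
    (I : BFun (Set.Icc m M) S ⊤ → ℝ) (hI : IsCertaintyEquivalent I)
    (hT : TranslationInvariant I) :
    ∃ A : (S → ℝ) → ℝ, IsAggregator A s₀ (M - m) ∧
      ∀ x : BFun (Set.Icc m M) S ⊤, A x = I x := by
  have : Nonempty S := ⟨s₀⟩
  have hne : (Finset.univ : Finset S).Nonempty := Finset.univ_nonempty
  -- `φ` is cut from below relative to `φ s₀`, then from above relative to the minimum `a φ` of the
  -- result. What remains has oscillation at most `M - m`, so a translate `b φ` lies in `[m, M]`.
  -- Both cuts commute with adding constants and leave functions already in `[m, M]` unchanged; the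
  -- cut tied to `s₀` gives the bound `near` for arbitrary `φ`.
  let c (φ : S → ℝ) (s : S) : ℝ := max (φ s) (φ s₀ - (M - m))
  let a (φ : S → ℝ) : ℝ := Finset.univ.inf' hne (c φ)
  have ha (φ : S → ℝ) (s : S) : a φ ≤ c φ s := Finset.inf'_le _ (Finset.mem_univ s)
  have hac (φ : S → ℝ) : ∃ s, a φ = c φ s := by
    obtain ⟨s, -, hs⟩ := Finset.exists_mem_eq_inf' hne (c φ)
    exact ⟨s, hs⟩
  let b (φ : S → ℝ) : BFun (Set.Icc m M) S ⊤ :=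
    BFun.ofFinite (fun s => min (c φ s) (a φ + (M - m)) - a φ + m) fun s =>
      ⟨by linarith [le_min (ha φ s) (show a φ ≤ a φ + (M - m) by linarith)],
        by linarith [min_le_right (c φ s) (a φ + (M - m))]⟩
  have hb (φ : S → ℝ) (s : S) : b φ s = min (c φ s) (a φ + (M - m)) - a φ + m := rfl
  let cst : BFun (Set.Icc m M) S ⊤ := BFun.ofFinite (fun _ => m) fun _ => ⟨le_rfl, hm⟩
  have hcst : I cst = m := hI.normalized m ⟨le_rfl, hm⟩ _ fun _ => rfl
  have hcs₀ (φ : S → ℝ) : c φ s₀ = φ s₀ := max_eq_left (by linarith)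
  have hext (x : BFun (Set.Icc m M) S ⊤) : I (b x) + a x - m = I x := by
    have hc (s : S) : c x s = x s := max_eq_left (by linarith [(x.mem' s).1, (x.mem' s₀).2])
    obtain ⟨s₁, hs₁⟩ := hac x
    have : I x = I (b x) + (a x - m) := by
      refine hT _ _ _ fun s => ?_
      rw [hb, hc, min_eq_left]
      · ring
      · rw [hs₁, hc]
        linarith [(x.mem' s).2, (x.mem' s₁).1]
    linarith
  refine ⟨fun φ => I (b φ) + a φ - m, ⟨fun φ ψ h => ?_, fun φ k => ?_, fun k => ?_, fun φ => ?_⟩,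
    hext⟩
  · have hc (s : S) : c φ s ≤ c ψ s := max_le_max (h s) (by linarith [h s₀])
    have haa : a φ ≤ a ψ := by
      obtain ⟨s, hs⟩ := hac ψ
      rw [hs]
      exact (ha φ s).trans (hc s)
    -- `b` itself need not be monotone, since the base level `a` moves; the Lipschitz bound absorbs
    -- the difference of base levels.
    have := hI.le_add hT hm (b φ) (b ψ) (a ψ - a φ) fun s => by
      rw [hb, hb]
      linarith [min_le_min (hc s) (add_le_add_left haa (M - m))]
    linarith
  · have hc (s : S) : c (fun s => φ s + k) s = c φ s + k := by
      simp only [c]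
      rw [← max_add_add_right]
      congr 1
      ring
    have haa : a (fun s => φ s + k) = a φ + k := by
      apply le_antisymm
      · obtain ⟨s, hs⟩ := hac φ
        rw [hs, ← hc]
        exact ha _ s
      · obtain ⟨s, hs⟩ := hac (fun s => φ s + k)
        rw [hs, hc]
        linarith [ha φ s]
    have hbb : b (fun s => φ s + k) = b φ := BFun.ext_fun fun s => by
      rw [hb, hb, hc, haa, show a φ + k + (M - m) = a φ + (M - m) + k by ring,
        min_add_add_right]
      ring
    simp only [hbb, haa]
    ring
  · obtain ⟨s, hs⟩ := hac fun _ => k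
    have hc (s : S) : c (fun _ => k) s = k := max_eq_left (a := k) (by linarith)
    rw [hc s] at hs
    have hbb : b (fun _ => k) = cst := BFun.ext_fun fun s => by
      rw [hb, hc s, hs, min_eq_left (by linarith)]
      change k - k + m = m
      ring
    simp only [hbb, hcst, hs]
    ring
  · rw [abs_le]
    have haφ : a φ ≤ φ s₀ := (ha φ s₀).trans (hcs₀ φ).le
    have hφa : φ s₀ - (M - m) ≤ a φ := by
      obtain ⟨s, hs⟩ := hac φ
      rw [hs]
      exact le_max_right _ _
    have hmem := hI.mem_Icc hm (b φ)
    constructor <;> linarith [hmem.1, hmem.2]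

/-! ### Iterated aggregation over infinitely many shocks -/

section Aggregation

variable {S : Type*} {A : (S → ℝ) → ℝ} {s₀ : S} {N : ℝ}

theorem IsAggregator.abs_sub_le (hA : IsAggregator A s₀ N) (φ ψ : S → ℝ) (δ : ℝ)
    (h : ∀ s, |φ s - ψ s| ≤ δ) : |A φ - A ψ| ≤ δ := by
  have h1 := hA.mono φ (fun s => ψ s + δ) fun s => by linarith [(abs_le.1 (h s)).2]
  have h2 := hA.mono ψ (fun s => φ s + δ) fun s => by linarith [(abs_le.1 (h s)).1]
  rw [hA.add_const] at h1 h2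
  rw [abs_le]
  constructor <;> linarith

theorem IsAggregator.tendsto [Finite S] (hA : IsAggregator A s₀ N) {α : Type*} {l : Filter α}
    {φ : α → S → ℝ} {ψ : S → ℝ} (h : ∀ s, Tendsto (fun a => φ a s) l (𝓝 (ψ s))) :
    Tendsto (fun a => A (φ a)) l (𝓝 (A ψ)) := by
  rw [Metric.tendsto_nhds]
  intro ε hε
  have h' : ∀ᶠ a in l, ∀ s, dist (φ a s) (ψ s) < ε / 2 :=
    eventually_all.2 fun s => Metric.tendsto_nhds.1 (h s) _ (half_pos hε)
  filter_upwards [h'] with a ha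
  rw [Real.dist_eq]
  exact (hA.abs_sub_le _ _ (ε / 2) fun s => (ha s).le).trans_lt (half_lt_self hε)

/-- The certainty equivalent, at scale `r`, of the first `n` shocks of `ξ`, the later ones being
frozen at `s₀`. The scale is multiplied by `β` in each period. -/
def iterAgg (A : (S → ℝ) → ℝ) (s₀ : S) (β : ℝ) : ℕ → ℝ → (States S → ℝ) → ℝ
  | 0, _, ξ => ξ fun _ => s₀
  | n + 1, r, ξ => r * A fun s => iterAgg A s₀ β n (r * β) (fun ω => ξ (consState s ω)) / r

/-- The limit of `iterAgg` as the number of resolved shocks grows. -/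
def limAgg (A : (S → ℝ) → ℝ) (s₀ : S) (β r : ℝ) (ξ : States S → ℝ) : ℝ :=
  limUnder atTop fun n => iterAgg A s₀ β n r ξ

theorem consState_const (s : S) : consState s (fun _ => s) = fun _ => s := by
  funext i
  cases i <;> rfl

theorem setFirst_consState (s t : S) (ω : States S) :
    setFirst s (consState t ω) = consState s ω := by
  funext i
  cases i <;> rfl

variable {β : ℝ}

/-- The additional shock is aggregated at scale `r β^n`, where `near` costs at most `r β^n N`. The
outer aggregations are nonexpansive at every scale and do not enlarge the error. -/
theorem iterAgg_succ_sub (hA : IsAggregator A s₀ N) (hβ : 0 < β) (n : ℕ) {r : ℝ} (hr : 0 < r)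
    (ξ : States S → ℝ) :
    |iterAgg A s₀ β (n + 1) r ξ - iterAgg A s₀ β n r ξ| ≤ r * N * β ^ n := by
  induction n generalizing r ξ with
  | zero =>
    have h := hA.near fun s => ξ (consState s fun _ => s₀) / r
    simp only [iterAgg, consState_const, pow_zero, mul_one] at h ⊢
    have : r * A (fun s => ξ (consState s fun _ => s₀) / r) - ξ (fun _ => s₀)
        = r * (A (fun s => ξ (consState s fun _ => s₀) / r) - ξ (fun _ => s₀) / r) := by
      field_simp
    rw [this, abs_mul, abs_of_pos hr]
    exact mul_le_mul_of_nonneg_left h hr.le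
  | succ n ih =>
    rw [iterAgg, iterAgg, ← mul_sub, abs_mul, abs_of_pos hr, mul_assoc]
    refine mul_le_mul_of_nonneg_left (hA.abs_sub_le _ _ _ fun s => ?_) hr.le
    rw [← sub_div, abs_div, abs_of_pos hr, div_le_iff₀ hr]
    refine (ih (mul_pos hr hβ) _).trans_eq ?_
    ring

theorem tendsto_iterAgg (hA : IsAggregator A s₀ N) (hβ : 0 < β) (hβ1 : β < 1) {r : ℝ}
    (hr : 0 < r) (ξ : States S → ℝ) :
    Tendsto (fun n => iterAgg A s₀ β n r ξ) atTop (𝓝 (limAgg A s₀ β r ξ)) := by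
  refine (cauchySeq_of_le_geometric β (r * N) hβ1 fun n => ?_).tendsto_limUnder
  rw [dist_comm, Real.dist_eq]
  exact iterAgg_succ_sub hA hβ n hr ξ

theorem dist_iterAgg_limAgg (hA : IsAggregator A s₀ N) (hβ : 0 < β) (hβ1 : β < 1) {r : ℝ}
    (hr : 0 < r) (ξ : States S → ℝ) (n : ℕ) :
    dist (iterAgg A s₀ β n r ξ) (limAgg A s₀ β r ξ) ≤ r * N * β ^ n / (1 - β) := by
  refine dist_le_of_le_geometric_of_tendsto β (r * N) hβ1 (fun n => ?_)
    (tendsto_iterAgg hA hβ hβ1 hr ξ) n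
  rw [dist_comm, Real.dist_eq]
  exact iterAgg_succ_sub hA hβ n hr ξ

theorem iterAgg_mono (hA : IsAggregator A s₀ N) (hβ : 0 < β) (n : ℕ) {r : ℝ} (hr : 0 < r)
    {ξ η : States S → ℝ} (h : ∀ ω, ξ ω ≤ η ω) :
    iterAgg A s₀ β n r ξ ≤ iterAgg A s₀ β n r η := by
  induction n generalizing r ξ η with
  | zero => exact h _
  | succ n ih =>
    refine mul_le_mul_of_nonneg_left (hA.mono _ _ fun s => ?_) hr.le
    exact div_le_div_of_nonneg_right (ih (mul_pos hr hβ) fun ω => h _) hr.le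

/-- `A` need not be positively homogeneous. Homogeneity holds because the scale is multiplied
together with the function, which is what discounting by one period does to a lifetime utility. -/
theorem iterAgg_affine (hA : IsAggregator A s₀ N) (hβ : 0 < β) (n : ℕ) {r q : ℝ} (hr : 0 < r)
    (hq : 0 < q) (ξ : States S → ℝ) (c : ℝ) :
    iterAgg A s₀ β n (r * q) (fun ω => r * ξ ω + c) = r * iterAgg A s₀ β n q ξ + c := by
  induction n generalizing q ξ with
  | zero => rfl
  | succ n ih =>
    have : ∀ s, iterAgg A s₀ β n (r * q * β) (fun ω => r * ξ (consState s ω) + c) / (r * q)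
        = iterAgg A s₀ β n (q * β) (fun ω => ξ (consState s ω)) / q + c / (r * q) := fun s => by
      rw [mul_assoc, ih (mul_pos hq hβ)]
      field_simp
    rw [iterAgg, iterAgg]
    simp only [this]
    rw [hA.add_const]
    field_simp

theorem iterAgg_const (hA : IsAggregator A s₀ N) (n : ℕ) {r : ℝ} (hr : r ≠ 0)
    (hβ : 0 < β) (c : ℝ) : iterAgg A s₀ β n r (fun _ => c) = c := by
  induction n generalizing r with
  | zero => rfl
  | succ n ih =>
    simp only [iterAgg]
    rw [ih (mul_ne_zero hr hβ.ne'), hA.const]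
    field_simp

theorem tendsto_iterAgg_of_pointwise [Finite S] (hA : IsAggregator A s₀ N) (n : ℕ) (r : ℝ)
    {α : Type*} {l : Filter α} {ξ : α → States S → ℝ} {η : States S → ℝ}
    (h : ∀ ω, Tendsto (fun a => ξ a ω) l (𝓝 (η ω))) :
    Tendsto (fun a => iterAgg A s₀ β n r (ξ a)) l (𝓝 (iterAgg A s₀ β n r η)) := by
  induction n generalizing r ξ η with
  | zero => exact h _
  | succ n ih => exact (hA.tendsto fun s => (ih _ fun ω => h _).div_const r).const_mul r

theorem limAgg_mono (hA : IsAggregator A s₀ N) (hβ : 0 < β) (hβ1 : β < 1) {r : ℝ} (hr : 0 < r)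
    {ξ η : States S → ℝ} (h : ∀ ω, ξ ω ≤ η ω) :
    limAgg A s₀ β r ξ ≤ limAgg A s₀ β r η :=
  le_of_tendsto_of_tendsto' (tendsto_iterAgg hA hβ hβ1 hr ξ) (tendsto_iterAgg hA hβ hβ1 hr η)
    fun n => iterAgg_mono hA hβ n hr h

theorem limAgg_affine (hA : IsAggregator A s₀ N) (hβ : 0 < β) (hβ1 : β < 1) {r q : ℝ}
    (hr : 0 < r) (hq : 0 < q) (ξ : States S → ℝ) (c : ℝ) :
    limAgg A s₀ β (r * q) (fun ω => r * ξ ω + c) = r * limAgg A s₀ β q ξ + c := by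
  refine tendsto_nhds_unique (tendsto_iterAgg hA hβ hβ1 (mul_pos hr hq) _) ?_
  simp only [iterAgg_affine hA hβ _ hr hq]
  exact ((tendsto_iterAgg hA hβ hβ1 hq ξ).const_mul r).add_const c

theorem limAgg_add_const (hA : IsAggregator A s₀ N) (hβ : 0 < β) (hβ1 : β < 1) {r : ℝ}
    (hr : 0 < r) (ξ : States S → ℝ) (c : ℝ) :
    limAgg A s₀ β r (fun ω => ξ ω + c) = limAgg A s₀ β r ξ + c := by
  simpa using limAgg_affine hA hβ hβ1 one_pos hr ξ c

theorem limAgg_const (hA : IsAggregator A s₀ N) (hβ : 0 < β) (hβ1 : β < 1) {r : ℝ} (hr : 0 < r)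
    (c : ℝ) : limAgg A s₀ β r (fun _ => c) = c := by
  refine tendsto_nhds_unique (tendsto_iterAgg hA hβ hβ1 hr _) ?_
  simp only [iterAgg_const hA _ hr.ne' hβ]
  exact tendsto_const_nhds

/-- Pointwise convergence suffices: `iterAgg` at stage `n` evaluates its argument at finitely many
states only, and its distance to the limit is bounded uniformly in the argument. -/
theorem tendsto_limAgg_of_pointwise [Finite S] (hA : IsAggregator A s₀ N) (hβ : 0 < β)
    (hβ1 : β < 1) {r : ℝ} (hr : 0 < r) {α : Type*} {l : Filter α} {ξ : α → States S → ℝ}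
    {η : States S → ℝ} (h : ∀ ω, Tendsto (fun a => ξ a ω) l (𝓝 (η ω))) :
    Tendsto (fun a => limAgg A s₀ β r (ξ a)) l (𝓝 (limAgg A s₀ β r η)) := by
  rw [Metric.tendsto_nhds]
  intro ε hε
  have hlim : Tendsto (fun n : ℕ => r * N * β ^ n / (1 - β)) atTop (𝓝 0) := by
    simpa using ((tendsto_pow_atTop_nhds_zero_of_lt_one hβ.le hβ1).const_mul (r * N)).div_const
      (1 - β)
  obtain ⟨n, hn⟩ := (hlim.eventually_lt_const (show 0 < ε / 3 by positivity)).exists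
  filter_upwards [Metric.tendsto_nhds.1 (tendsto_iterAgg_of_pointwise (β := β) hA n r h) (ε / 3)
    (by positivity)] with a ha
  have h1 := dist_iterAgg_limAgg hA hβ hβ1 hr (ξ a) n
  have h2 := dist_iterAgg_limAgg hA hβ hβ1 hr η n
  rw [dist_comm] at h1
  have := dist_triangle4 (limAgg A s₀ β r (ξ a)) (iterAgg A s₀ β n r (ξ a)) (iterAgg A s₀ β n r η)
    (limAgg A s₀ β r η)
  linarith

theorem limAgg_eq [Finite S] (hA : IsAggregator A s₀ N) (hβ : 0 < β) (hβ1 : β < 1) {r : ℝ}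
    (hr : 0 < r) (ξ : States S → ℝ) :
    limAgg A s₀ β r ξ
      = r * A fun s => limAgg A s₀ β (r * β) (fun ω => ξ (consState s ω)) / r := by
  refine tendsto_nhds_unique ((tendsto_add_atTop_iff_nat 1).2 (tendsto_iterAgg hA hβ hβ1 hr ξ)) ?_
  exact (hA.tendsto fun s =>
    (tendsto_iterAgg hA hβ hβ1 (mul_pos hr hβ) _).div_const r).const_mul r

/-- Once the first shock is overwritten, the outermost `A` is applied to a constant and drops out,
leaving the later shocks at the scale one period ahead. -/
theorem limAgg_setFirst [Finite S] (hA : IsAggregator A s₀ N) (hβ : 0 < β) (hβ1 : β < 1) {r : ℝ}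
    (hr : 0 < r) (ξ : States S → ℝ) (s : S) :
    limAgg A s₀ β r (fun ω => ξ (setFirst s ω))
      = limAgg A s₀ β (r * β) fun ω => ξ (consState s ω) := by
  rw [limAgg_eq hA hβ hβ1 hr]
  simp only [setFirst_consState]
  rw [hA.const]
  field_simp

/-- Generalized rectangularity of the limit of iterated certainty equivalents. -/
theorem limAgg_rectangular [Finite S] (hA : IsAggregator A s₀ N) (hβ : 0 < β) (hβ1 : β < 1)
    {r : ℝ} (hr : 0 < r) (ξ : States S → ℝ) :
    limAgg A s₀ β r ξ
      = r * A fun s => limAgg A s₀ β r (fun ω => ξ (setFirst s ω)) / r := by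
  simp only [limAgg_setFirst hA hβ hβ1 hr]
  exact limAgg_eq hA hβ hβ1 hr ξ

end Aggregation

/-! ### Mixtures of lotteries -/

section Lotteries

variable {C : Type*} [TopologicalSpace C] [MeasurableSpace C] [BorelSpace C]

theorem mix_apply (a : unitInterval) (x y : ProbabilityMeasure C) :
    (mix a x y : Measure C)
      = ENNReal.ofReal (a : ℝ) • (x : Measure C) + ENNReal.ofReal (1 - (a : ℝ)) • (y : Measure C) :=
  rfl

theorem mix_symm (a : unitInterval) (x y : ProbabilityMeasure C) :
    mix (unitInterval.symm a) x y = mix a y x := by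
  apply Subtype.ext
  change (mix (unitInterval.symm a) x y : Measure C) = (mix a y x : Measure C)
  rw [mix_apply, mix_apply, add_comm, unitInterval.coe_symm_eq, sub_sub_cancel]

theorem mix_self (a : unitInterval) (x : ProbabilityMeasure C) : mix a x x = x := by
  apply Subtype.ext
  change (mix a x x : Measure C) = (x : Measure C)
  rw [mix_apply, ← add_smul, ← ENNReal.ofReal_add a.2.1 (by linarith [a.2.2])]
  simp

theorem mix_zero (x y : ProbabilityMeasure C) : mix 0 x y = y := by
  apply Subtype.ext
  change (mix 0 x y : Measure C) = (y : Measure C)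
  rw [mix_apply]
  simp

theorem mix_one (x y : ProbabilityMeasure C) : mix 1 x y = x := by
  apply Subtype.ext
  change (mix 1 x y : Measure C) = (x : Measure C)
  rw [mix_apply]
  simp

theorem mix_mix (r a b c : unitInterval) (hc : (c : ℝ) = r * a + (1 - r) * b)
    (x y : ProbabilityMeasure C) : mix r (mix a x y) (mix b x y) = mix c x y := by
  have hr := r.2
  have ha := a.2
  have hb := b.2
  have h1 : ENNReal.ofReal (c : ℝ)
      = ENNReal.ofReal r * ENNReal.ofReal a + ENNReal.ofReal (1 - r) * ENNReal.ofReal b := by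
    rw [hc, ENNReal.ofReal_add (mul_nonneg hr.1 ha.1) (mul_nonneg (by linarith [hr.2]) hb.1),
      ENNReal.ofReal_mul hr.1, ENNReal.ofReal_mul (by linarith [hr.2])]
  have h2 : ENNReal.ofReal (1 - (c : ℝ)) = ENNReal.ofReal r * ENNReal.ofReal (1 - a)
      + ENNReal.ofReal (1 - r) * ENNReal.ofReal (1 - b) := by
    rw [← ENNReal.ofReal_mul hr.1, ← ENNReal.ofReal_mul (by linarith [hr.2]),
      ← ENNReal.ofReal_add (mul_nonneg hr.1 (by linarith [ha.2]))
        (mul_nonneg (by linarith [hr.2]) (by linarith [hb.2])), hc]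
    congr 1
    ring
  apply Subtype.ext
  change (mix r (mix a x y) (mix b x y) : Measure C) = (mix c x y : Measure C)
  rw [mix_apply, mix_apply, mix_apply, mix_apply, h1, h2]
  simp only [smul_add, add_smul, smul_smul]
  abel

theorem continuous_mix (x y : ProbabilityMeasure C) : Continuous fun a => mix a x y := by
  rw [ProbabilityMeasure.continuous_iff_forall_continuous_integral]
  intro f
  have (a : unitInterval) : ∫ c, f c ∂(mix a x y : Measure C)
      = (a : ℝ) * ∫ c, f c ∂(x : Measure C) + (1 - (a : ℝ)) * ∫ c, f c ∂(y : Measure C) := by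
    rw [mix_apply, integral_add_measure, integral_smul_measure, integral_smul_measure,
      ENNReal.toReal_ofReal a.2.1, ENNReal.toReal_ofReal (by linarith [a.2.2])]
    · rfl
    · exact (f.integrable _).smul_measure ENNReal.ofReal_ne_top
    · exact (f.integrable _).smul_measure ENNReal.ofReal_ne_top
  simp only [this]
  fun_prop

end Lotteries

/-! ### Discounted utility of deterministic plans -/

section Utility

variable {C : Type*} [TopologicalSpace C] [MeasurableSpace C] [BorelSpace C]
  {u : ProbabilityMeasure C → ℝ} {β : ℝ}

theorem exists_bound_of_continuous [CompactSpace C] [TopologicalSpace.MetrizableSpace C]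
    (hu : Continuous u) : ∃ B, ∀ x, |u x| ≤ B := by
  obtain ⟨B, hB⟩ := isCompact_univ.exists_bound_of_continuousOn hu.continuousOn
  exact ⟨B, fun x => hB x trivial⟩

theorem summable_discounted {B : ℝ} (hB : ∀ x, |u x| ≤ B) (hβ : 0 < β) (hβ1 : β < 1)
    (d : ℕ → ProbabilityMeasure C) : Summable fun t => β ^ t * u (d t) := by
  refine Summable.of_norm_bounded ((summable_geometric_of_lt_one hβ.le hβ1).mul_right B)
    fun t => ?_
  rw [norm_mul, norm_pow, Real.norm_of_nonneg hβ.le]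
  exact mul_le_mul_of_nonneg_left (hB _) (by positivity)

theorem continuous_discounted {B : ℝ} (hu : Continuous u) (hB : ∀ x, |u x| ≤ B) (hβ : 0 < β)
    (hβ1 : β < 1) : Continuous (discounted u β) := by
  refine continuous_tsum (u := fun t => β ^ t * B) (fun t => ?_)
    ((summable_geometric_of_lt_one hβ.le hβ1).mul_right B) fun t d => ?_
  · exact continuous_const.mul (hu.comp (continuous_apply t))
  · rw [norm_mul, norm_pow, Real.norm_of_nonneg hβ.le]
    exact mul_le_mul_of_nonneg_left (hB _) (by positivity)

theorem discounted_consSeq {B : ℝ} (hB : ∀ x, |u x| ≤ B) (hβ : 0 < β) (hβ1 : β < 1)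
    (x : ProbabilityMeasure C) (d : ℕ → ProbabilityMeasure C) :
    discounted u β (consSeq x d) = u x + β * discounted u β d := by
  rw [discounted, (summable_discounted hB hβ hβ1 _).tsum_eq_zero_add, discounted, ← tsum_mul_left]
  simp only [consSeq, pow_zero, one_mul, pow_succ']
  congr 1
  exact tsum_congr fun t => by ring

theorem discounted_const (hβ : 0 < β) (hβ1 : β < 1) (x : ProbabilityMeasure C) :
    discounted u β (fun _ => x) = u x / (1 - β) := by
  rw [discounted, tsum_mul_right, tsum_geometric_of_lt_one hβ.le hβ1, div_eq_inv_mul]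

theorem discounted_mix {B : ℝ} (hB : ∀ x, |u x| ≤ B) (ha : IsAffineUtility u) (hβ : 0 < β)
    (hβ1 : β < 1) (a : unitInterval) (d d' : ℕ → ProbabilityMeasure C) :
    discounted u β (fun t => mix a (d t) (d' t))
      = a * discounted u β d + (1 - a) * discounted u β d' := by
  rw [discounted, discounted, discounted, ← tsum_mul_left, ← tsum_mul_left,
    ← ((summable_discounted hB hβ hβ1 d).mul_left _).tsum_add
      ((summable_discounted hB hβ hβ1 d').mul_left _)]
  exact tsum_congr fun t => by rw [ha]; ring

/-- Extrema exist by compactness of `X^∞`, and mixing the two extremal plans attains every value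
between. -/
theorem range_discounted [CompactSpace C] [TopologicalSpace.MetrizableSpace C] [Nonempty C]
    (hu : Continuous u) (ha : IsAffineUtility u) (hβ : 0 < β) (hβ1 : β < 1) :
    ∃ m M, m ≤ M ∧ Set.range (discounted u β) = Set.Icc m M := by
  obtain ⟨B, hB⟩ := exists_bound_of_continuous hu
  have hne : Nonempty (ProbabilityMeasure C) :=
    ⟨⟨Measure.dirac (Classical.arbitrary C), inferInstance⟩⟩
  have hc := continuous_discounted hu hB hβ hβ1
  obtain ⟨p, -, hp⟩ := isCompact_univ.exists_isMaxOn Set.univ_nonempty hc.continuousOn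
  obtain ⟨q, -, hq⟩ := isCompact_univ.exists_isMinOn Set.univ_nonempty hc.continuousOn
  refine ⟨discounted u β q, discounted u β p, hp trivial, Set.Subset.antisymm ?_ fun v hv => ?_⟩
  · rintro _ ⟨d, rfl⟩
    exact ⟨hq trivial, hp trivial⟩
  · have hf : Continuous fun a : unitInterval =>
        (a : ℝ) * discounted u β p + (1 - a) * discounted u β q := by fun_prop
    obtain ⟨a, rfl⟩ := mem_range_of_exists_le_of_exists_ge hf
      ⟨0, by simpa using hv.1⟩ ⟨1, by simpa using hv.2⟩
    exact ⟨_, discounted_mix hB ha hβ hβ1 a p q⟩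

end Utility

/-! ### Adapted plans and their lifetime utility -/

section Plans

variable {S C : Type*} [TopologicalSpace C] [MeasurableSpace C] [BorelSpace C]
  {u : ProbabilityMeasure C → ℝ} {β : ℝ}

/-- Singletons of lotteries are Borel because the weak topology is metrizable, so measurability with
respect to `info S t` forces dependence on the first `t` shocks alone. -/
theorem Plan.at_congr [CompactSpace C] [TopologicalSpace.MetrizableSpace C] (h : Plan S C) (t : ℕ)
    {ω ω' : States S} (hω : ∀ i < t, ω i = ω' i) : h.at' t ω = h.at' t ω' := by
  have hs : MeasurableSet[borel (ProbabilityMeasure C)] {h.at' t ω} := by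
    borelize (ProbabilityMeasure C)
    exact measurableSet_singleton (h.at' t ω)
  obtain ⟨B, -, hB⟩ := h.adapted t hs
  have h1 : ω ∈ h.at' t ⁻¹' {h.at' t ω} := rfl
  rw [← hB] at h1
  have h2 : ω' ∈ (fun (ω : States S) (i : Fin t) => ω i) ⁻¹' B := by
    have : (fun i : Fin t => ω' i) = fun i : Fin t => ω i := funext fun i => (hω i i.2).symm
    rw [Set.mem_preimage, this]
    exact h1
  rw [hB] at h2
  exact Eq.symm h2

theorem Plan.at_zero [CompactSpace C] [TopologicalSpace.MetrizableSpace C] (h : Plan S C)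
    (ω ω' : States S) : h.at' 0 ω = h.at' 0 ω' :=
  h.at_congr 0 fun _ hi => absurd hi (Nat.not_lt_zero _)

theorem measurable_info_of_factor {X : Type*} (m : MeasurableSpace X) (t : ℕ)
    (f : States S → X) (g : (Fin t → S) → X) (h : ∀ ω, f ω = g fun i => ω i) :
    Measurable[info S t, m] f := by
  have : f = g ∘ fun (ω : States S) (i : Fin t) => ω i := funext h
  rw [this]
  exact @Measurable.comp _ _ _ (info S t) ⊤ m _ _ measurable_from_top (comap_measurable _)

theorem continuous_at (t : ℕ) (ω : States S) : Continuous fun h : Plan S C => h.at' t ω :=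
  (continuous_apply ω).comp ((continuous_apply t).comp continuous_induced_dom)

theorem continuous_det : Continuous (Plan.det : (ℕ → ProbabilityMeasure C) → Plan S C) :=
  continuous_induced_rng.2 <| continuous_pi fun t => continuous_pi fun _ => continuous_apply t

/-- The lifetime utility of a plan. -/
def lifetime {B : ℝ} (hu : Continuous u) (hB : ∀ x, |u x| ≤ B) (hβ : 0 < β) (hβ1 : β < 1)
    (h : Plan S C) : ExAnteDomain S u β where
  toFun ω := discounted u β fun t => h.at' t ω
  measurable' := by
    let _ : MeasurableSpace (States S) := infoAll S
    borelize (ProbabilityMeasure C)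
    refine measurable_of_tendsto_metrizable (f := fun n ω => ∑ t ∈ Finset.range n,
      β ^ t * u (h.at' t ω)) (fun n => Finset.measurable_sum _ fun t _ => ?_) ?_
    · have : Measurable (h.at' t) := (h.adapted t).mono (le_iSup (info S) t) le_rfl
      exact (hu.measurable.comp this).const_mul _
    · exact tendsto_pi_nhds.2 fun ω =>
        (summable_discounted hB hβ hβ1 fun t => h.at' t ω).hasSum.tendsto_sum_nat
  mem' ω := ⟨_, rfl⟩
  bounded' := by
    refine ⟨∑' t, β ^ t * B, fun ω => ?_⟩
    have hs := (summable_geometric_of_lt_one hβ.le hβ1).mul_right B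
    refine tsum_of_norm_bounded (f := fun t => β ^ t * u (h.at' t ω)) hs.hasSum fun t => ?_
    rw [norm_mul, norm_pow, Real.norm_of_nonneg hβ.le]
    exact mul_le_mul_of_nonneg_left (hB _) (by positivity)

theorem cont_concat (x : ProbabilityMeasure C) (h : Plan S C) (s : S) :
    (Plan.concat x h).cont s = h := rfl

theorem concat_det (x : ProbabilityMeasure C) (d : ℕ → ProbabilityMeasure C) :
    Plan.concat x (Plan.det d : Plan S C) = Plan.det (consSeq x d) := by
  ext t ω : 3
  cases t <;> rfl

theorem consSeq_eta (d : ℕ → ProbabilityMeasure C) :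
    consSeq (d 0) (fun t => d (t + 1)) = d := by
  funext t
  cases t <;> rfl

theorem cond_eq_concat [CompactSpace C] [TopologicalSpace.MetrizableSpace C] (h : Plan S C)
    (s : S) (ω : States S) : h.cond s = Plan.concat (h.at' 0 ω) (h.cont s) := by
  ext t ω' : 3
  cases t with
  | zero => exact h.at_zero _ _
  | succ t =>
    change h.at' (t + 1) _ = h.at' (t + 1) _
    congr 1

end Plans

/-! ### Consequences of a twofold representation -/

section Representation

variable {S C : Type*} [TopologicalSpace C] [MeasurableSpace C] [BorelSpace C]
  {R : Plan S C → Plan S C → Prop} {V : Plan S C → ℝ} {u : ProbabilityMeasure C → ℝ} {β : ℝ}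
  {I₁ : OneStepDomain S u β → ℝ} {I₀ : ExAnteDomain S u β → ℝ}

theorem exists_aggregator_of_eq_Icc [Fintype S] (s₀ : S) {K : Set ℝ} {m M : ℝ}
    (hK : K = Set.Icc m M) (hm : m ≤ M) (I : BFun K S ⊤ → ℝ) (hI : IsCertaintyEquivalent I)
    (hT : TranslationInvariant I) :
    ∃ A : (S → ℝ) → ℝ, IsAggregator A s₀ (M - m) ∧ ∀ x : BFun K S ⊤, A x = I x := by
  subst hK
  exact exists_aggregator s₀ hm I hI hT

/-- Prefixing any lottery makes `h` a continuation, and continuation values lie in the domain of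
`I₁` by the recursion. -/
theorem IsSeparableRecursive.mem_range [Nonempty S] [Nonempty C]
    (hR : IsSeparableRecursive R V u β I₁) (h : Plan S C) :
    V h ∈ Set.range (discounted u β) := by
  obtain ⟨φ, hφ, -⟩ := hR.recursive
    (Plan.concat ⟨Measure.dirac (Classical.arbitrary C), inferInstance⟩ h)
  have := φ.mem' (Classical.arbitrary S)
  rwa [hφ] at this

variable {A : (S → ℝ) → ℝ} {s₀ : S} {N : ℝ}

theorem IsSeparableRecursive.eq_add_aggregator (hR : IsSeparableRecursive R V u β I₁)
    (hAI : ∀ x : OneStepDomain S u β, A x = I₁ x) (h : Plan S C) (ω : States S) :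
    V h = u (h.at' 0 ω) + β * A fun s => V (h.cont s) := by
  obtain ⟨φ, hφ, hV⟩ := hR.recursive h
  rw [hV ω, ← hAI]
  congr 3
  exact funext hφ

variable [CompactSpace C] [TopologicalSpace.MetrizableSpace C]

theorem discounted_consState {B : ℝ} (hB : ∀ x, |u x| ≤ B) (hβ : 0 < β) (hβ1 : β < 1)
    (h : Plan S C) (s : S) (ω : States S) :
    discounted u β (fun t => h.at' t (consState s ω))
      = β * discounted u β (fun t => (h.cont s).at' t ω) + u (h.at' 0 ω) := by
  rw [← consSeq_eta fun t => h.at' t (consState s ω), discounted_consSeq hB hβ hβ1,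
    h.at_zero (consState s ω) ω, add_comm]
  rfl

/-- A recursive value is the limit of the iterated certainty equivalents of lifetime utility. -/
theorem IsSeparableRecursive.limAgg_eq_value [Finite S] [Nonempty C]
    (hR : IsSeparableRecursive R V u β I₁) (ha : IsAffineUtility u) (hA : IsAggregator A s₀ N)
    (hAI : ∀ x : OneStepDomain S u β, A x = I₁ x) (h : Plan S C) :
    limAgg A s₀ β β (fun ω => discounted u β fun t => h.at' t ω) = V h := by
  have hS : Nonempty S := ⟨s₀⟩
  obtain ⟨hβ, hβ1⟩ := hR.discount
  obtain ⟨B, hB⟩ := exists_bound_of_continuous hR.continuous_u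
  obtain ⟨m, M, -, hK⟩ := range_discounted hR.continuous_u ha hβ hβ1
  have hmem (d) : discounted u β d ∈ Set.Icc m M := hK ▸ ⟨d, rfl⟩
  let J (h : Plan S C) := limAgg A s₀ β β fun ω => discounted u β fun t => h.at' t ω
  -- `J` satisfies the recursion of `V`: passing to a continuation multiplies lifetime utility by
  -- `β` up to the constant `u(h₀)`, and the scale changes from `β` to `β * β` accordingly.
  have hJ (h : Plan S C) : J h = u (h.at' 0 fun _ => s₀) + β * A fun s => J (h.cont s) := by
    have (s : S) : limAgg A s₀ β (β * β)
        (fun ω => discounted u β fun t => h.at' t (consState s ω)) / β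
        = J (h.cont s) + u (h.at' 0 fun _ => s₀) / β := by
      have h0 (ω) : u (h.at' 0 ω) = u (h.at' 0 fun _ => s₀) := by rw [h.at_zero]
      simp only [discounted_consState hB hβ hβ1, h0]
      rw [limAgg_affine hA hβ hβ1 hβ hβ]
      field_simp
      rfl
    simp only [J]
    rw [limAgg_eq hA hβ hβ1 hβ]
    simp only [this]
    rw [hA.add_const]
    field_simp
    ring
  -- Both `J` and `V` take values in `[m, M]`, and each use of the recursion shrinks the uniform gap
  -- by `β`.
  have hbound (n : ℕ) : ∀ h : Plan S C, |J h - V h| ≤ β ^ n * (M - m) := by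
    induction n with
    | zero =>
      intro h
      have h1 : V h ∈ Set.Icc m M := hK ▸ hR.mem_range h
      have h2 : m ≤ J h := by
        rw [← limAgg_const hA hβ hβ1 hβ m]
        exact limAgg_mono hA hβ hβ1 hβ fun ω => (hmem _).1
      have h3 : J h ≤ M := by
        rw [← limAgg_const hA hβ hβ1 hβ M]
        exact limAgg_mono hA hβ hβ1 hβ fun ω => (hmem _).2
      rw [abs_le]
      constructor <;> linarith [h1.1, h1.2]
    | succ n ih =>
      intro h
      rw [hJ h, hR.eq_add_aggregator hAI h fun _ => s₀, add_sub_add_left_eq_sub, ← mul_sub, abs_mul,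
        abs_of_pos hβ, pow_succ', mul_assoc]
      exact mul_le_mul_of_nonneg_left (hA.abs_sub_le _ _ _ fun s => ih _) hβ.le
  have hlim : Tendsto (fun n => β ^ n * (M - m)) atTop (𝓝 0) := by
    simpa using (tendsto_pow_atTop_nhds_zero_of_lt_one hβ.le hβ1).mul_const (M - m)
  have := ge_of_tendsto' hlim fun n => hbound n h
  exact sub_eq_zero.1 (abs_nonpos_iff.1 this)

theorem IsSeparableRecursive.exists_aggregator [Fintype S] [Nonempty C]
    (hR : IsSeparableRecursive R V u β I₁) (ha : IsAffineUtility u)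
    (hT : TranslationInvariant I₁) (s₀ : S) :
    ∃ A N, IsAggregator A s₀ N ∧ ∀ x : OneStepDomain S u β, A x = I₁ x := by
  obtain ⟨m, M, hm, hK⟩ := range_discounted hR.continuous_u ha hR.discount.1 hR.discount.2
  obtain ⟨A, hA⟩ := exists_aggregator_of_eq_Icc s₀ hK hm I₁ hR.certaintyEquivalent hT
  exact ⟨A, _, hA⟩

/-- Every separable recursive representation with translation invariant certainty equivalent has
an ex ante counterpart which satisfies generalized rectangularity throughout. -/
theorem IsSeparableRecursive.isTwofold [Finite S] [Nonempty C]
    (hR : IsSeparableRecursive R V u β I₁) (ha : IsAffineUtility u) (hu : ∃ x y, u x ≠ u y)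
    (hT : TranslationInvariant I₁) (hA : IsAggregator A s₀ N)
    (hAI : ∀ x : OneStepDomain S u β, A x = I₁ x) :
    IsTwofoldRepresentation R V u β I₁ fun ξ => limAgg A s₀ β β ξ := by
  obtain ⟨hβ, hβ1⟩ := hR.discount
  obtain ⟨B, hB⟩ := exists_bound_of_continuous hR.continuous_u
  refine ⟨hR, ha, hu, hT, ⟨fun ξn ξ h => ?_, fun ξ ξ' h => ?_, fun k _ ξ h => ?_⟩,
    fun ξ η k h => ?_, V, hR.represents, fun h => ?_⟩
  · exact tendsto_limAgg_of_pointwise hA hβ hβ1 hβ h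
  · exact limAgg_mono hA hβ hβ1 hβ h
  · simp only [funext h]
    exact limAgg_const hA hβ hβ1 hβ k
  · simp only [funext h]
    exact limAgg_add_const hA hβ hβ1 hβ ξ k
  · exact ⟨lifetime hR.continuous_u hB hβ hβ1 h, fun ω => rfl,
      (hR.limAgg_eq_value ha hA hAI h).symm⟩

theorem generalizedRectangularityAt_limAgg [Finite S] (hβ : 0 < β) (hβ1 : β < 1)
    (hA : IsAggregator A s₀ N) (hAI : ∀ x : OneStepDomain S u β, A x = I₁ x)
    (ξ : ExAnteDomain S u β) :
    GeneralizedRectangularityAt I₁ (fun ξ => limAgg A s₀ β β ξ) ξ := by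
  intro k φ hφ
  have := hA.add_const (fun s => (1 / β) * limAgg A s₀ β β (ξ.condition s)) k
  rw [← hAI, funext hφ, this, add_sub_cancel_right]
  refine (limAgg_rectangular hA hβ hβ1 hβ ξ).trans ?_
  congr 2
  funext s
  rw [div_mul_eq_mul_div, one_mul]
  rfl

theorem IsSeparableRecursive.value_det [Fintype S] [Nonempty S] [Nonempty C]
    (hR : IsSeparableRecursive R V u β I₁) (ha : IsAffineUtility u)
    (hT : TranslationInvariant I₁) (d : ℕ → ProbabilityMeasure C) :
    V (Plan.det d) = discounted u β d := by
  obtain ⟨A, N, hA, hAI⟩ := hR.exists_aggregator ha hT (Classical.arbitrary S)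
  rw [← hR.limAgg_eq_value ha hA hAI]
  exact limAgg_const hA hR.discount.1 hR.discount.2 hR.discount.1 (discounted u β d)

theorem IsSeparableRecursive.value_mono [Fintype S] [Nonempty S] [Nonempty C]
    (hR : IsSeparableRecursive R V u β I₁) (ha : IsAffineUtility u)
    (hT : TranslationInvariant I₁) {h g : Plan S C}
    (hgh : ∀ ω, discounted u β (fun t => g.at' t ω) ≤ discounted u β fun t => h.at' t ω) :
    V g ≤ V h := by
  obtain ⟨A, N, hA, hAI⟩ := hR.exists_aggregator ha hT (Classical.arbitrary S)
  rw [← hR.limAgg_eq_value ha hA hAI, ← hR.limAgg_eq_value ha hA hAI]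
  exact limAgg_mono hA hR.discount.1 hR.discount.2 hR.discount.1 hgh

theorem IsSeparableRecursive.continuous_value [Fintype S] [Nonempty S] [Nonempty C]
    (hR : IsSeparableRecursive R V u β I₁) (ha : IsAffineUtility u)
    (hT : TranslationInvariant I₁) : Continuous V := by
  obtain ⟨A, N, hA, hAI⟩ := hR.exists_aggregator ha hT (Classical.arbitrary S)
  obtain ⟨hβ, hβ1⟩ := hR.discount
  obtain ⟨B, hB⟩ := exists_bound_of_continuous hR.continuous_u
  rw [← funext fun h => hR.limAgg_eq_value ha hA hAI h, continuous_iff_continuousAt]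
  intro h
  refine tendsto_limAgg_of_pointwise hA hβ hβ1 hβ fun ω => ?_
  exact ((continuous_discounted hR.continuous_u hB hβ hβ1).comp
    (continuous_pi fun t => continuous_at t ω)).tendsto h

theorem IsSeparableRecursive.value_concat [Fintype S] [Nonempty S] [Nonempty C]
    (hR : IsSeparableRecursive R V u β I₁) (ha : IsAffineUtility u)
    (hT : TranslationInvariant I₁) (x : ProbabilityMeasure C) (h : Plan S C) :
    V (Plan.concat x h) = u x + β * V h := by
  obtain ⟨A, N, hA, hAI⟩ := hR.exists_aggregator ha hT (Classical.arbitrary S)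
  rw [hR.eq_add_aggregator hAI _ fun _ => Classical.arbitrary S]
  simp only [cont_concat, hA.const]
  rfl

/-- The ex ante functional computes the recursive value. -/
theorem IsTwofoldRepresentation.exAnte_eq [Fintype S] [Nonempty S] [Nonempty C]
    (hR : IsTwofoldRepresentation R V u β I₁ I₀) {h : Plan S C} {ξ : ExAnteDomain S u β}
    (hξ : IsLifetimeUtility ξ h) : I₀ ξ = V h := by
  obtain ⟨W, hW, hWI⟩ := hR.exAnte
  have hWI' (h : Plan S C) (ξ : ExAnteDomain S u β) (hξ : IsLifetimeUtility ξ h) :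
      I₀ ξ = W h := by
    obtain ⟨η, hη, hWη⟩ := hWI h
    rw [hWη, BFun.ext_fun fun ω => (hξ ω).trans (hη ω).symm]
  have hWdet (d) : W (Plan.det d) = discounted u β d := by
    obtain ⟨η, hη, hWη⟩ := hWI (Plan.det d)
    rw [hWη]
    exact hR.certaintyEquivalent₀.normalized _ ⟨d, rfl⟩ η hη
  -- A deterministic plan with utility `V h` is indifferent to `h`, so `W` takes the same value at
  -- both; at the deterministic plan normalization forces that value.
  obtain ⟨d, hd⟩ := hR.recursive.mem_range h
  have hV := hR.recursive.value_det hR.affine_u hR.translation₁ d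
  have h1 := (hR.recursive.represents h (Plan.det d)).2 (hV.trans hd).le
  have h2 := (hR.recursive.represents (Plan.det d) h).2 (hV.trans hd).ge
  rw [hWI' h ξ hξ, le_antisymm ((hW _ _).1 h2) ((hW _ _).1 h1), hWdet, hd]

/-- Generalized rectangularity at lifetime utilities, whose right-hand side is always defined. -/
theorem IsTwofoldRepresentation.generalizedRectangularityAt [Fintype S] [Nonempty S] [Nonempty C]
    (hR : IsTwofoldRepresentation R V u β I₁ I₀) {h : Plan S C} {ξ : ExAnteDomain S u β}
    (hξ : IsLifetimeUtility ξ h) :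
    (∃ k φ, IsTranslatedContinuation I₀ ξ k φ) ∧ GeneralizedRectangularityAt I₁ I₀ ξ := by
  obtain ⟨hβ, -⟩ := hR.recursive.discount
  obtain ⟨φ, hφ, hV⟩ := hR.recursive.recursive h
  let ω₀ : States S := fun _ => Classical.arbitrary S
  have hcond (s : S) : I₀ (ξ.condition s) = u (h.at' 0 ω₀) + β * V (h.cont s) := by
    have hs : IsLifetimeUtility (ξ.condition s) (h.cond s) := fun ω => hξ (setFirst s ω)
    rw [hR.exAnte_eq hs, cond_eq_concat h s ω₀,
      hR.recursive.value_concat hR.affine_u hR.translation₁]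
  -- Conditioning on `s` gives `(h₀, h^{s,1})`, of value `u(h₀) + β V(h^{s,1})`; subtracting `u(h₀)
  -- / β` after division by `β` leaves the continuation value.
  refine ⟨⟨-(u (h.at' 0 ω₀) / β), φ, fun s => ?_⟩, fun k ψ hψ => ?_⟩
  · rw [hφ, hcond]
    field_simp
    ring
  · have : I₁ ψ = I₁ φ + (u (h.at' 0 ω₀) / β + k) := by
      refine hR.translation₁ φ ψ _ fun s => ?_
      rw [hψ, hφ, hcond]
      field_simp
      ring
    rw [hR.exAnte_eq hξ, hV ω₀, this]
    field_simp
    ring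

theorem IsTwofoldRepresentation.satisfiesAxioms [Fintype S] [Nonempty S] [Nonempty C]
    (hR : IsTwofoldRepresentation R V u β I₁ I₀) : SatisfiesAxioms R := by
  have hV := hR.recursive.represents
  have ha := hR.affine_u
  have hT := hR.translation₁
  obtain ⟨hβ, hβ1⟩ := hR.recursive.discount
  obtain ⟨B, hB⟩ := exists_bound_of_continuous hR.recursive.continuous_u
  have hcont := hR.recursive.continuous_value ha hT
  have hdet := hR.recursive.value_det ha hT
  have hcc := hR.recursive.value_concat ha hT
  have hindiff (h g) : Indiff R h g ↔ V h = V g := by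
    rw [Indiff, hV, hV, le_antisymm_iff, and_comm]
  constructor
  · intro h g
    rw [hV, hV]
    exact le_total _ _
  · intro h g f
    rw [hV, hV, hV]
    exact fun h1 h2 => h2.trans h1
  · intro g
    rw [show {h | R h g} = {h | V g ≤ V h} from Set.ext fun h => hV h g]
    exact isClosed_le continuous_const hcont
  · intro g
    rw [show {h | R g h} = {h | V h ≤ V g} from Set.ext fun h => hV g h]
    exact isClosed_le hcont continuous_const
  · obtain ⟨x, y, hxy⟩ := hR.nonconstant_u
    have key (x y) (h : u x < u y) :
        R (Plan.det fun _ => y) (Plan.det fun _ => x) ∧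
          ¬ R (Plan.det fun _ => x) (Plan.det fun _ => y) := by
      rw [hV, hV, hdet, hdet, discounted_const hβ hβ1, discounted_const hβ hβ1, not_le]
      have := div_lt_div_of_pos_right h (sub_pos.2 hβ1)
      exact ⟨this.le, this⟩
    rcases lt_or_gt_of_ne hxy with h | h
    exacts [⟨y, x, key x y h⟩, ⟨x, y, key y x h⟩]
  · intro x y x' y' d d'
    simp only [hindiff, hdet, discounted_consSeq hB hβ hβ1]
    constructor <;> intro h <;> linarith
  · intro x h g
    rw [hV, hV, hcc, hcc, add_le_add_iff_left, mul_le_mul_iff_right₀ hβ]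
  · intro d d' d'' a _ _ h
    rw [hindiff, hdet, hdet] at h ⊢
    rw [discounted_mix hB ha hβ hβ1, discounted_mix hB ha hβ hβ1, h]
  · intro h g h0 hs
    let ω₀ : States S := fun _ => Classical.arbitrary S
    obtain ⟨φ, hφ, hh⟩ := hR.recursive.recursive h
    obtain ⟨ψ, hψ, hg⟩ := hR.recursive.recursive g
    rw [hV, hh ω₀, hg ω₀, h0, add_le_add_iff_left, mul_le_mul_iff_right₀ hβ]
    refine hR.recursive.certaintyEquivalent.monotone φ ψ fun s => ?_
    have := (hV _ _).1 (hs s)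
    rw [cond_eq_concat h s ω₀, cond_eq_concat g s ω₀, hcc, hcc, h0, add_le_add_iff_left,
      mul_le_mul_iff_right₀ hβ] at this
    rwa [hφ, hψ]
  · intro h g hω
    rw [hV]
    refine hR.recursive.value_mono ha hT fun ω => ?_
    have := (hV _ _).1 (hω ω)
    rwa [hdet, hdet] at this

end Representation

/-! ### Weak orders on a segment -/

/-- A continuous weak order on a segment that satisfies independence and ranks the endpoints
strictly is the order of the segment. -/
theorem not_rel_of_lt_of_independence {Q : ℝ → ℝ → Prop} (hc : ∀ a b, Q a b ∨ Q b a)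
    (ht : ∀ a b c, Q a b → Q b c → Q a c) (hu : ∀ b, IsClosed {a | Q a b})
    (hl : ∀ b, IsClosed {a | Q b a})
    (hi : ∀ a ∈ Set.Icc (0 : ℝ) 1, ∀ b ∈ Set.Icc (0 : ℝ) 1, ∀ c ∈ Set.Icc (0 : ℝ) 1,
      ∀ r ∈ Set.Ioo (0 : ℝ) 1, Q a b → Q b a → Q (r * a + (1 - r) * c) (r * b + (1 - r) * c))
    (hn : ¬ Q 0 1) {a b : ℝ} (ha : a ∈ Set.Icc (0 : ℝ) 1) (hb : b ∈ Set.Icc (0 : ℝ) 1)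
    (hab : a < b) : ¬ Q a b := by
  have hinj : ∀ a ∈ Set.Icc (0 : ℝ) 1, ∀ b ∈ Set.Icc (0 : ℝ) 1, a < b → Q a b → ¬ Q b a := by
    intro a ha b hb hab h1 h2
    -- Mixing the indifferent pair `a, b` with `c = (p - r a) / (1 - r)` moves it to `p, p + r (b -
    -- a)`; the two inequalities say exactly that `c` lies in `[0, 1]`.
    have hpair (p r : ℝ) (hr : 0 < r) (hr1 : r < 1) (hp : r * a ≤ p)
        (hp1 : p + r * (1 - a) ≤ 1) :
        Q p (p + r * (b - a)) ∧ Q (p + r * (b - a)) p := by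
      have hcc : (p - r * a) / (1 - r) ∈ Set.Icc (0 : ℝ) 1 :=
        ⟨div_nonneg (by linarith) (by linarith), (div_le_one (by linarith)).2 (by linarith)⟩
      have e : (1 - r) * ((p - r * a) / (1 - r)) = p - r * a :=
        mul_div_cancel₀ _ (by linarith)
      have q1 := hi a ha b hb _ hcc r ⟨hr, hr1⟩ h1 h2
      have q2 := hi b hb a ha _ hcc r ⟨hr, hr1⟩ h2 h1
      rw [e, show r * a + (p - r * a) = p by ring,
        show r * b + (p - r * a) = p + r * (b - a) by ring] at q1 q2
      exact ⟨q1, q2⟩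
    have hall : ∀ x ∈ Set.Ioo (0 : ℝ) 1, ∀ y ∈ Set.Ioo (0 : ℝ) 1, Q x y ∧ Q y x := by
      intro x hx y hy
      refine isPreconnected_Ioo.induction₂ (fun x y => Q x y ∧ Q y x) (fun x hx => ?_)
        (fun x y z _ _ _ h h' => ⟨ht _ _ _ h.1 h'.1, ht _ _ _ h'.2 h.2⟩)
        (fun x y _ _ h => h.symm) hx hy
      -- Indifference is thus locally constant on the open segment. By connectedness the open
      -- segment is one indifference class, and closedness extends this to the endpoints, against
      -- `hn`.
      have hρ : 0 < min x (1 - x) := lt_min hx.1 (by linarith [hx.2])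
      refine mem_nhdsWithin_of_mem_nhds (Metric.mem_nhds_iff.2
        ⟨min x (1 - x) * (b - a), mul_pos hρ (sub_pos.2 hab), fun y hy => ?_⟩)
      rw [Metric.mem_ball, Real.dist_eq] at hy
      have hba := sub_pos.2 hab
      rcases lt_trichotomy x y with hxy | rfl | hxy
      · have hr : 0 < (y - x) / (b - a) := div_pos (sub_pos.2 hxy) hba
        have hr1 : (y - x) / (b - a) < min x (1 - x) := by
          rw [div_lt_iff₀ hba]
          exact (le_abs_self _).trans_lt hy
        obtain ⟨l1, l2⟩ := lt_min_iff.1 hr1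
        have := hpair x ((y - x) / (b - a)) hr (by linarith)
          (by nlinarith [ha.1, ha.2]) (by nlinarith [ha.1, ha.2])
        rwa [div_mul_cancel₀ _ hba.ne', add_sub_cancel] at this
      · exact ⟨(hc x x).elim id id, (hc x x).elim id id⟩
      · have hr : 0 < (x - y) / (b - a) := div_pos (sub_pos.2 hxy) hba
        have hr1 : (x - y) / (b - a) < min x (1 - x) := by
          rw [div_lt_iff₀ hba]
          rw [abs_sub_comm] at hy
          exact (le_abs_self _).trans_lt hy
        obtain ⟨l1, l2⟩ := lt_min_iff.1 hr1
        have e : (x - y) / (b - a) * (b - a) = x - y := div_mul_cancel₀ _ hba.ne'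
        have := hpair y ((x - y) / (b - a)) hr (by linarith)
          (by nlinarith [hb.1, hb.2]) (by nlinarith [hb.1, hb.2])
        rw [e, add_sub_cancel] at this
        exact this.symm
    have hcl : ∀ T : Set ℝ, IsClosed T → Set.Ioo (0 : ℝ) 1 ⊆ T → 0 ∈ T ∧ 1 ∈ T := by
      intro T hT hsub
      have := closure_minimal hsub hT
      rw [closure_Ioo zero_ne_one] at this
      exact ⟨this ⟨le_rfl, zero_le_one⟩, this ⟨zero_le_one, le_rfl⟩⟩
    have hhalf : (1 / 2 : ℝ) ∈ Set.Ioo (0 : ℝ) 1 := by norm_num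
    exact hn (ht _ _ _ (hcl _ (hu (1 / 2)) fun x hx => (hall x hx _ hhalf).1).1
      (hcl _ (hl (1 / 2)) fun x hx => (hall x hx _ hhalf).2).2)
  -- Without indifferent pairs no ranking can be reversed: a reversal would give two nonempty closed
  -- sets covering a connected set, and a common point is an indifference. This is applied first
  -- against the endpoint `0`, then against `b`.
  have hzero : ∀ q ∈ Set.Ioc (0 : ℝ) 1, ¬ Q 0 q := by
    intro q hq h
    obtain ⟨x, hx, h1, h2⟩ := isPreconnected_closed_iff.1 (isPreconnected_Ioc (a := (0 : ℝ)) (b := 1))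
      _ _ (hl 0) (hu 0) (fun x _ => hc 0 x) ⟨q, hq, h⟩
      ⟨1, ⟨zero_lt_one, le_rfl⟩, (hc 0 1).resolve_left hn⟩
    exact hinj 0 ⟨le_rfl, zero_le_one⟩ x ⟨hx.1.le, hx.2⟩ hx.1 h1 h2
  intro h
  have hb0 : 0 < b := ha.1.trans_lt hab
  obtain ⟨x, hx, h1, h2⟩ := isPreconnected_closed_iff.1 (isPreconnected_Ico (a := (0 : ℝ)) (b := b))
    _ _ (hu b) (hl b) (fun x _ => hc x b) ⟨a, ⟨ha.1, hab⟩, h⟩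
    ⟨0, ⟨le_rfl, hb0⟩, (hc 0 b).resolve_left (hzero b ⟨hb0, hb.2⟩)⟩
  exact hinj x ⟨hx.1, hx.2.le.trans hb.2⟩ b hb hx.2 h1 h2

/-! ### Calibration by the best and the worst deterministic plan -/

section Axioms

variable {S C : Type*} [TopologicalSpace C] [MeasurableSpace C] [BorelSpace C] [CompactSpace C]
  [TopologicalSpace.MetrizableSpace C] {R : Plan S C → Plan S C → Prop}

theorem SatisfiesAxioms.refl (hR : SatisfiesAxioms R) (h : Plan S C) : R h h :=
  (hR.complete h h).elim id id

/-- The upper contour sets are nonempty, compact and directed by the weak order, so they have a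
common point. -/
theorem SatisfiesAxioms.exists_best [Nonempty C] (hR : SatisfiesAxioms R) :
    ∃ p : ℕ → ProbabilityMeasure C, ∀ d, R (Plan.det p) (Plan.det d) := by
  have hne : Nonempty (ProbabilityMeasure C) :=
    ⟨⟨Measure.dirac (Classical.arbitrary C), inferInstance⟩⟩
  have hcl (d : ℕ → ProbabilityMeasure C) :
      IsClosed {p : ℕ → ProbabilityMeasure C | R (Plan.det p) (Plan.det d)} :=
    (hR.closed_upper (Plan.det d)).preimage continuous_det
  obtain ⟨p, hp⟩ := IsCompact.nonempty_iInter_of_directed_nonempty_isCompact_isClosed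
    (fun d : ℕ → ProbabilityMeasure C => {p | R (Plan.det p) (Plan.det d)})
    (fun d d' => (hR.complete (Plan.det d) (Plan.det d')).elim
      (fun h => ⟨d, fun _ hx => hx, fun _ hx => hR.transitive _ _ _ hx h⟩)
      (fun h => ⟨d', fun _ hx => hR.transitive _ _ _ hx h, fun _ hx => hx⟩))
    (fun d => ⟨d, hR.refl _⟩) (fun d => (hcl d).isCompact) hcl
  exact ⟨p, fun d => Set.mem_iInter.1 hp d⟩

theorem SatisfiesAxioms.exists_worst [Nonempty C] (hR : SatisfiesAxioms R) :
    ∃ q : ℕ → ProbabilityMeasure C, ∀ d, R (Plan.det d) (Plan.det q) := by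
  have hne : Nonempty (ProbabilityMeasure C) :=
    ⟨⟨Measure.dirac (Classical.arbitrary C), inferInstance⟩⟩
  have hcl (d : ℕ → ProbabilityMeasure C) :
      IsClosed {q : ℕ → ProbabilityMeasure C | R (Plan.det d) (Plan.det q)} :=
    (hR.closed_lower (Plan.det d)).preimage continuous_det
  obtain ⟨q, hq⟩ := IsCompact.nonempty_iInter_of_directed_nonempty_isCompact_isClosed
    (fun d : ℕ → ProbabilityMeasure C => {q | R (Plan.det d) (Plan.det q)})
    (fun d d' => (hR.complete (Plan.det d) (Plan.det d')).elim
      (fun h => ⟨d', fun _ hx => hR.transitive _ _ _ h hx, fun _ hx => hx⟩)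
      (fun h => ⟨d, fun _ hx => hx, fun _ hx => hR.transitive _ _ _ h hx⟩))
    (fun d => ⟨d, hR.refl _⟩) (fun d => (hcl d).isCompact) hcl
  exact ⟨q, fun d => Set.mem_iInter.1 hq d⟩

/-- A continuous representation with values in `[0, 1]` that is affine on deterministic plans. The
path `γ` of deterministic plans is a section of it. -/
structure IsAffineValue (R : Plan S C → Plan S C → Prop) (V : Plan S C → ℝ)
    (γ : ℝ → ℕ → ProbabilityMeasure C) : Prop where
  represents : Represents R V
  mem_Icc : ∀ h, V h ∈ Set.Icc (0 : ℝ) 1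
  path : ∀ a ∈ Set.Icc (0 : ℝ) 1, V (Plan.det (γ a)) = a
  affine : ∀ (a : unitInterval) (d d' : ℕ → ProbabilityMeasure C),
    V (Plan.det fun t => mix a (d t) (d' t))
      = a * V (Plan.det d) + (1 - a) * V (Plan.det d')
  continuous : Continuous V
  continuous_path : Continuous γ

theorem SatisfiesAxioms.exists_affineValue [Nonempty C] (hR : SatisfiesAxioms R) :
    ∃ V γ, IsAffineValue R V γ := by
  obtain ⟨p, hp⟩ := hR.exists_best
  obtain ⟨q, hq⟩ := hR.exists_worst
  let γ (a : ℝ) (t : ℕ) : ProbabilityMeasure C := mix (Set.projIcc 0 1 zero_le_one a) (p t) (q t)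
  have hγ (a : unitInterval) : γ a = fun t => mix a (p t) (q t) := by
    funext t
    simp only [γ, Set.projIcc_val]
  have hγ0 : γ 0 = q := by
    rw [show (0 : ℝ) = ((0 : unitInterval) : ℝ) from rfl, hγ]
    exact funext fun t => mix_zero _ _
  have hγ1 : γ 1 = p := by
    rw [show (1 : ℝ) = ((1 : unitInterval) : ℝ) from rfl, hγ]
    exact funext fun t => mix_one _ _
  have hγc : Continuous γ :=
    continuous_pi fun t => (continuous_mix (p t) (q t)).comp continuous_projIcc
  have hγmix (r a b : unitInterval) (c : ℝ) (hc : c = r * a + (1 - r) * b) :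
      (fun t => mix r (γ a t) (γ b t)) = γ c := by
    have hmem : c ∈ Set.Icc (0 : ℝ) 1 := by
      rw [hc]
      exact (convex_Icc (0 : ℝ) 1) a.2 b.2 r.2.1 (by linarith [r.2.2]) (by ring)
    have := hγ ⟨c, hmem⟩
    rw [this, hγ, hγ]
    exact funext fun t => mix_mix r a b ⟨c, hmem⟩ hc _ _
  let f (a : ℝ) : Plan S C := Plan.det (γ a)
  have hf : Continuous f := continuous_det.comp hγc
  have hlt : ∀ {a b : ℝ}, a ∈ Set.Icc (0 : ℝ) 1 → b ∈ Set.Icc (0 : ℝ) 1 → a < b →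
      ¬ R (f a) (f b) := by
    refine not_rel_of_lt_of_independence (Q := fun a b => R (f a) (f b))
      (fun a b => hR.complete _ _) (fun a b c => hR.transitive _ _ _)
      (fun b => (hR.closed_upper (f b)).preimage hf)
      (fun b => (hR.closed_lower (f b)).preimage hf) ?_ ?_
    · intro a ha b hb c hc r hr h1 h2
      have := hR.independence (γ a) (γ b) (γ c) ⟨r, hr.1.le, hr.2.le⟩ hr.1 hr.2 ⟨h1, h2⟩
      rw [hγmix ⟨r, hr.1.le, hr.2.le⟩ ⟨a, ha⟩ ⟨c, hc⟩ _ rfl,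
        hγmix ⟨r, hr.1.le, hr.2.le⟩ ⟨b, hb⟩ ⟨c, hc⟩ _ rfl] at this
      exact this.1
    · intro h
      simp only [f, hγ0, hγ1] at h
      obtain ⟨x, y, -, hxy⟩ := hR.nontrivial
      exact hxy (hR.transitive _ _ _ (hR.transitive _ _ _ (hq _) h) (hp _))
  -- State monotonicity places every plan between the worst and the best deterministic plan, and
  -- connectedness of the segment gives an indifferent point.
  have hex (h : Plan S C) : ∃ a ∈ Set.Icc (0 : ℝ) 1, R h (f a) ∧ R (f a) h := by
    obtain ⟨a, ha, h1, h2⟩ := isPreconnected_closed_iff.1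
      (isPreconnected_Icc (a := (0 : ℝ)) (b := 1)) _ _
      ((hR.closed_lower h).preimage hf) ((hR.closed_upper h).preimage hf)
      (fun a _ => hR.complete _ _)
      ⟨0, ⟨le_rfl, zero_le_one⟩, hR.state_monotone _ _ fun ω => by
        simp only [f, hγ0]
        exact hq _⟩
      ⟨1, ⟨zero_le_one, le_rfl⟩, hR.state_monotone _ _ fun ω => by
        simp only [f, hγ1]
        exact hp _⟩
    exact ⟨a, ha, h1, h2⟩
  choose V hV hVl hVr using hex
  have hrep : Represents R V := by
    intro h g
    constructor
    · intro hgh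
      by_contra! hlt'
      exact hlt (hV h) (hV g) hlt'
        (hR.transitive _ _ _ (hVr h) (hR.transitive _ _ _ hgh (hVl g)))
    · intro hle
      refine hR.transitive _ _ _ (hVl h) (hR.transitive _ _ _ ?_ (hVr g))
      rcases hle.eq_or_lt with e | hl
      · rw [e]
        exact hR.refl _
      · exact (hR.complete _ _).resolve_right (hlt (hV g) (hV h) hl)
  have hpath : ∀ a ∈ Set.Icc (0 : ℝ) 1, V (f a) = a := by
    intro a ha
    rcases lt_trichotomy (V (f a)) a with hl | he | hl
    · exact absurd (hVr (f a)) (hlt (hV _) ha hl)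
    · exact he
    · exact absurd (hVl (f a)) (hlt ha (hV _) hl)
  have hindiff {h g : Plan S C} (e : V h = V g) : Indiff R h g :=
    ⟨(hrep _ _).2 e.ge, (hrep _ _).2 e.le⟩
  have hmixl (a : unitInterval) (h0 : 0 < a) (h1 : a < 1) (d d' d'' : ℕ → ProbabilityMeasure C)
      (e : V (Plan.det d) = V (Plan.det d')) :
      V (Plan.det fun t => mix a (d t) (d'' t)) = V (Plan.det fun t => mix a (d' t) (d'' t)) := by
    have := hR.independence d d' d'' a h0 h1 (hindiff e)
    exact le_antisymm ((hrep _ _).1 this.2) ((hrep _ _).1 this.1)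
  refine ⟨V, γ, hrep, hV, hpath, fun a d d' => ?_, ?_, hγc⟩
  · rcases a.2.1.eq_or_lt with h0 | h0
    · have : a = 0 := Subtype.ext h0.symm
      subst this
      simp [mix_zero]
    rcases a.2.2.eq_or_lt with h1 | h1
    · have : a = 1 := Subtype.ext h1
      subst this
      simp [mix_one]
    -- Independence replaces `d` and `d'`, one at a time, by their equivalents on `γ`, along which
    -- mixing is ordinary convex combination of parameters.
    have e1 := hmixl a h0 h1 d (γ (V (Plan.det d))) d' (hpath _ (hV _)).symm
    have e2 := hmixl (unitInterval.symm a) (by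
        rw [← Subtype.coe_lt_coe, unitInterval.coe_symm_eq]
        exact sub_pos.2 h1) (by
        rw [← Subtype.coe_lt_coe, unitInterval.coe_symm_eq]
        exact sub_lt_self _ h0) d' (γ (V (Plan.det d'))) (γ (V (Plan.det d)))
      (hpath _ (hV _)).symm
    simp only [mix_symm] at e2
    rw [e1, e2, hγmix a ⟨_, hV _⟩ ⟨_, hV _⟩ _ rfl]
    exact hpath _ ((convex_Icc (0 : ℝ) 1) (hV _) (hV _) a.2.1 (by linarith [a.2.2]) (by ring))
  -- Sub- and superlevel sets at levels in `[0, 1]` are contour sets of points of the segment; at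
  -- other levels they are empty or everything.
  · have hle (a : ℝ) (ha : a ∈ Set.Icc (0 : ℝ) 1) : IsClosed {h | V h ≤ a} := by
      have : {h | V h ≤ a} = {h | R (f a) h} := Set.ext fun h => by
        rw [Set.mem_ofPred_eq, Set.mem_ofPred_eq, hrep, hpath a ha]
      rw [this]
      exact hR.closed_lower _
    have hge (a : ℝ) (ha : a ∈ Set.Icc (0 : ℝ) 1) : IsClosed {h | a ≤ V h} := by
      have : {h | a ≤ V h} = {h | R h (f a)} := Set.ext fun h => by
        rw [Set.mem_ofPred_eq, Set.mem_ofPred_eq, hrep, hpath a ha]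
      rw [this]
      exact hR.closed_upper _
    rw [continuous_iff_lower_upperSemicontinuous, lowerSemicontinuous_iff_isClosed_preimage,
      upperSemicontinuous_iff_isClosed_preimage]
    refine ⟨fun y => ?_, fun y => ?_⟩
    · rcases lt_or_ge y 0 with h0 | h0
      · convert isClosed_empty
        exact Set.eq_empty_of_forall_notMem fun h hh => (h0.trans_le (hV h).1).not_ge hh
      rcases le_or_gt y 1 with h1 | h1
      · exact hle y ⟨h0, h1⟩
      · convert isClosed_univ
        exact Set.eq_univ_of_forall fun h => (hV h).2.trans h1.le
    · rcases lt_or_ge y 0 with h0 | h0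
      · convert isClosed_univ
        exact Set.eq_univ_of_forall fun h => h0.le.trans (hV h).1
      rcases le_or_gt y 1 with h1 | h1
      · exact hge y ⟨h0, h1⟩
      · convert isClosed_empty
        exact Set.eq_empty_of_forall_notMem fun h hh => ((hV h).2.trans_lt h1).not_ge hh

end Axioms

/-! ### The recursive representation from the axioms -/

section Recursion

variable {S C : Type*} [TopologicalSpace C] [MeasurableSpace C] [BorelSpace C]

/-- The plan that pays `x` at first and then follows the deterministic plan `d s`, where `s` is the
first shock. -/
def Plan.branch (x : ProbabilityMeasure C) (d : S → ℕ → ProbabilityMeasure C) : Plan S C where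
  at' t ω := consSeq x (d (ω 0)) t
  adapted t := by
    cases t with
    | zero => exact @measurable_const _ _ (borel (ProbabilityMeasure C)) (info S 0) x
    | succ t => exact measurable_info_of_factor _ (t + 1) _ (fun p => d (p 0) t) fun _ => rfl

theorem branch_const (x : ProbabilityMeasure C) (d : ℕ → ProbabilityMeasure C) :
    (Plan.branch x fun _ : S => d) = Plan.det (consSeq x d) := rfl

theorem concat_branch_at (x y : ProbabilityMeasure C) (d : S → ℕ → ProbabilityMeasure C)
    (ω : States S) : (fun t => (Plan.concat x (Plan.branch y d)).at' t ω)
      = consSeq x (consSeq y (d (ω 1))) := by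
  funext t
  cases t <;> rfl

theorem mix_consSeq (a : unitInterval) (x y : ProbabilityMeasure C)
    (d d' : ℕ → ProbabilityMeasure C) :
    (fun t => mix a (consSeq x d t) (consSeq y d' t))
      = consSeq (mix a x y) fun t => mix a (d t) (d' t) := by
  funext t
  cases t <;> rfl

theorem continuous_consSeq (d : ℕ → ProbabilityMeasure C) : Continuous fun x => consSeq x d :=
  continuous_pi fun t => by
    cases t
    exacts [continuous_id, continuous_const]

theorem tendsto_iterate_consSeq (z : ProbabilityMeasure C) (d : ℕ → ProbabilityMeasure C) :
    Tendsto (fun n => (consSeq z)^[n] d) atTop (𝓝 fun _ => z) := by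
  have h (n t : ℕ) (ht : t < n) : (consSeq z)^[n] d t = z := by
    induction n generalizing t with
    | zero => exact absurd ht (Nat.not_lt_zero _)
    | succ n ih =>
      rw [Function.iterate_succ_apply']
      cases t with
      | zero => rfl
      | succ t => exact ih t (Nat.lt_of_succ_lt_succ ht)
  refine tendsto_pi_nhds.2 fun t => tendsto_const_nhds.congr' ?_
  filter_upwards [eventually_gt_atTop t] with n hn
  exact (h n t hn).symm

variable [CompactSpace C] [TopologicalSpace.MetrizableSpace C] {R : Plan S C → Plan S C → Prop}
  {V : Plan S C → ℝ} {γ : ℝ → ℕ → ProbabilityMeasure C}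

theorem IsAffineValue.eq_of_indiff (hV : IsAffineValue R V γ) {h g : Plan S C}
    (hhg : R h g) (hgh : R g h) : V h = V g :=
  le_antisymm ((hV.represents _ _).1 hgh) ((hV.represents _ _).1 hhg)

theorem IsAffineValue.concat_congr (hV : IsAffineValue R V γ) (hR : SatisfiesAxioms R)
    (x : ProbabilityMeasure C) {h g : Plan S C} (e : V h = V g) :
    V (Plan.concat x h) = V (Plan.concat x g) :=
  hV.eq_of_indiff ((hR.stationary x h g).1 ((hV.represents _ _).2 e.ge))
    ((hR.stationary x g h).1 ((hV.represents _ _).2 e.le))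

/-- Stationarity makes the value of deterministic plans a discounted sum. -/
theorem IsAffineValue.exists_utility (hV : IsAffineValue R V γ) (hR : SatisfiesAxioms R)
    [Nonempty C] :
    ∃ (u : ProbabilityMeasure C → ℝ) (β : ℝ), Continuous u ∧ IsAffineUtility u ∧ 0 < β ∧ β < 1 ∧
      (∀ x h, V (Plan.concat x h) = u x + β * V h) ∧ ∀ d, V (Plan.det d) = discounted u β d := by
  have hp : V (Plan.det (γ 1)) = 1 := hV.path 1 ⟨zero_le_one, le_rfl⟩
  have hq : V (Plan.det (γ 0)) = 0 := hV.path 0 ⟨le_rfl, zero_le_one⟩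
  let x₀ : ProbabilityMeasure C := ⟨Measure.dirac (Classical.arbitrary C), inferInstance⟩
  let F (d : ℕ → ProbabilityMeasure C) : ℝ := V (Plan.det d)
  have hF : Continuous F := hV.continuous.comp continuous_det
  let u (x : ProbabilityMeasure C) : ℝ := F (consSeq x (γ 0))
  let b (x : ProbabilityMeasure C) : ℝ := F (consSeq x (γ 1)) - u x
  -- The even mixture of `(x, best)` with `(y, worst)` is the same plan as that of `(x, worst)` with
  -- `(y, best)`, so the slope in the continuation does not depend on the first lottery.
  have hb (x y : ProbabilityMeasure C) : b x = b y := by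
    let a : unitInterval := ⟨1 / 2, by norm_num, by norm_num⟩
    have e : unitInterval.symm a = a := Subtype.ext (by
      rw [unitInterval.coe_symm_eq]
      norm_num [a])
    have h1 := hV.affine a (consSeq x (γ 1)) (consSeq y (γ 0))
    have h2 := hV.affine a (consSeq x (γ 0)) (consSeq y (γ 1))
    have h3 : (fun t => mix a (γ 1 t) (γ 0 t)) = fun t => mix a (γ 0 t) (γ 1 t) :=
      funext fun t => by rw [← mix_symm, e]
    rw [mix_consSeq] at h1 h2
    rw [h3, h2] at h1
    simp only [b, u, F]
    norm_num [a] at h1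
    linarith
  -- By stationarity `h` may be replaced by the mixture of best and worst that has its value.
  have hcons (x : ProbabilityMeasure C) (h : Plan S C) :
      V (Plan.concat x h) = u x + b x₀ * V h := by
    let a : unitInterval := ⟨V h, hV.mem_Icc h⟩
    have h0 : V h = V (Plan.det fun t => mix a (γ 1 t) (γ 0 t)) := by
      rw [hV.affine, hp, hq]
      simp [a]
    rw [hV.concat_congr hR x h0, concat_det, ← mix_self a x, ← mix_consSeq, hV.affine, hb x₀ x,
      mix_self]
    simp only [b, u, F, a]
    ring
  have hβ : 0 < b x₀ := by
    by_contra! hle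
    have h1 := hcons x₀ (Plan.det (γ 1))
    have h2 := hcons x₀ (Plan.det (γ 0))
    rw [hp] at h1
    rw [hq] at h2
    have := (hR.stationary x₀ (Plan.det (γ 0)) (Plan.det (γ 1))).2
      ((hV.represents _ _).2 (by linarith))
    have := (hV.represents _ _).1 this
    rw [hp, hq] at this
    linarith
  have hFcons (x : ProbabilityMeasure C) (d) : F (consSeq x d) = u x + b x₀ * F d := by
    rw [← hcons, concat_det]
  -- Prefixing `x₀` `n` times to the best and to the worst plan gives values that differ by `β^n`;
  -- both sequences of plans converge to constant `x₀`, so continuity forces `β^n → 0`.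
  have hβ1 : b x₀ < 1 := by
    have hdiff (n : ℕ) :
        F ((consSeq x₀)^[n] (γ 1)) - F ((consSeq x₀)^[n] (γ 0)) = b x₀ ^ n := by
      induction n with
      | zero =>
        simp only [Function.iterate_zero, id, pow_zero, F, hp, hq, sub_zero]
      | succ n ih =>
        rw [Function.iterate_succ_apply', Function.iterate_succ_apply', hFcons, hFcons, pow_succ',
          ← ih]
        ring
    have hlim := ((hF.tendsto _).comp (tendsto_iterate_consSeq x₀ (γ 1))).sub
      ((hF.tendsto _).comp (tendsto_iterate_consSeq x₀ (γ 0)))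
    rw [sub_self] at hlim
    have := tendsto_pow_atTop_nhds_zero_iff.1 (hlim.congr hdiff)
    exact (le_abs_self _).trans_lt this
  have huB (x : ProbabilityMeasure C) : |u x| ≤ 1 := by
    rw [abs_of_nonneg (hV.mem_Icc _).1]
    exact (hV.mem_Icc _).2
  refine ⟨u, b x₀, hF.comp (continuous_consSeq _), fun a x y => ?_, hβ, hβ1, hcons, fun d => ?_⟩
  · have := hV.affine a (consSeq x (γ 0)) (consSeq y (γ 0))
    rw [mix_consSeq] at this
    simp only [mix_self] at this
    exact this
  · have hsum (n : ℕ) : ∀ d : ℕ → ProbabilityMeasure C,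
        F d - ∑ t ∈ Finset.range n, b x₀ ^ t * u (d t) = b x₀ ^ n * F fun t => d (t + n) := by
      induction n with
      | zero => intro d; simp
      | succ n ih =>
        intro d
        rw [Finset.sum_range_succ, ← sub_sub, ih d, ← consSeq_eta fun t => d (t + n), hFcons,
          Nat.zero_add]
        simp only [Nat.add_right_comm _ 1 n]
        ring_nf
    have hs := (summable_discounted huB hβ hβ1 d).hasSum.tendsto_sum_nat
    have hz : Tendsto (fun n => F d - ∑ t ∈ Finset.range n, b x₀ ^ t * u (d t)) atTop (𝓝 0) := by
      simp only [hsum _ d]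
      refine squeeze_zero (fun n => mul_nonneg (pow_nonneg hβ.le n) (hV.mem_Icc _).1)
        (fun n => ?_) (tendsto_pow_atTop_nhds_zero_of_lt_one hβ.le hβ1)
      exact mul_le_of_le_one_right (pow_nonneg hβ.le n) (hV.mem_Icc _).2
    exact sub_eq_zero.1 (tendsto_nhds_unique (hs.const_sub (F d)) hz)

theorem IsAffineValue.state_mono (hV : IsAffineValue R V γ) (hR : SatisfiesAxioms R)
    {h g : Plan S C}
    (hgh : ∀ ω, V (Plan.det fun t => g.at' t ω) ≤ V (Plan.det (S := S) fun t => h.at' t ω)) :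
    V g ≤ V h :=
  (hV.represents _ _).1 (hR.state_monotone h g fun ω => (hV.represents _ _).2 (hgh ω))

/-- `I₁ φ` is read off a plan that reveals one shock and then continues deterministically with value
`φ s`. -/
theorem SatisfiesAxioms.exists_recursive [Finite S] [Nonempty S] [Nonempty C]
    (hR : SatisfiesAxioms R) :
    ∃ (V : Plan S C → ℝ) (u : ProbabilityMeasure C → ℝ) (β : ℝ) (I₁ : OneStepDomain S u β → ℝ),
      IsSeparableRecursive R V u β I₁ ∧ IsAffineUtility u ∧ (∃ x y, u x ≠ u y) ∧
        TranslationInvariant I₁ := by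
  obtain ⟨V, γ, hV⟩ := hR.exists_affineValue
  obtain ⟨u, β, hu, ha, hβ, hβ1, hconcat, hdet⟩ := hV.exists_utility hR
  let x₀ : ProbabilityMeasure C := ⟨Measure.dirac (Classical.arbitrary C), inferInstance⟩
  have hdc (x : ProbabilityMeasure C) (d) :
      V (Plan.det (consSeq x d)) = u x + β * V (Plan.det d) := by
    rw [← concat_det, hconcat]
  have hrange : Set.range (discounted u β) = Set.Icc 0 1 := by
    refine Set.Subset.antisymm ?_ fun a h => ⟨γ a, by rw [← hdet, hV.path a h]⟩
    rintro _ ⟨d, rfl⟩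
    rw [← hdet]
    exact hV.mem_Icc _
  have hmem (φ : OneStepDomain S u β) (s : S) : φ s ∈ Set.Icc (0 : ℝ) 1 := hrange ▸ φ.mem' s
  have hnc : ∃ x y, u x < u y := by
    by_contra! hcon
    have : ∀ d : ℕ → ProbabilityMeasure C, discounted u β d = discounted u β fun _ => x₀ := by
      intro d
      simp only [discounted, le_antisymm (hcon x₀ (d _)) (hcon (d _) x₀)]
    have h1 := hV.path 1 ⟨zero_le_one, le_rfl⟩
    have h0 := hV.path 0 ⟨le_rfl, zero_le_one⟩
    rw [hdet, this] at h0 h1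
    linarith
  let E (x : ProbabilityMeasure C) (φ : S → ℝ) : ℝ := V (Plan.branch x fun s => γ (φ s))
  have hbr (x) (φ : S → ℝ) (ω : States S) :
      (fun t => (Plan.branch x fun s => γ (φ s)).at' t ω) = consSeq x (γ (φ (ω 0))) := rfl
  have hshift (x y : ProbabilityMeasure C) (φ ψ : OneStepDomain S u β)
      (h : ∀ s, u x + β * φ s ≤ u y + β * ψ s) : E x φ ≤ E y ψ := by
    refine hV.state_mono hR fun ω => ?_
    rw [hbr, hbr, hdc, hdc, hV.path _ (hmem φ _), hV.path _ (hmem ψ _)]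
    exact h _
  have hE (y : ProbabilityMeasure C) (φ : OneStepDomain S u β) :
      E y φ - u y = E x₀ φ - u x₀ := by
    -- The weight `β` gives `u(x₀) + β u(y) = u(x') + β u(x₀)`. With the branching delayed by one
    -- period, the two plans thus have equal utility in every state.
    let x' := mix ⟨β, hβ.le, hβ1.le⟩ y x₀
    have hx' : u x' = β * u y + (1 - β) * u x₀ := ha _ _ _
    have : V (Plan.concat x₀ (Plan.branch y fun s => γ (φ s)))
        = V (Plan.concat x' (Plan.branch x₀ fun s => γ (φ s))) := by
      apply le_antisymm <;> refine hV.state_mono hR fun ω => le_of_eq ?_ <;>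
      · rw [concat_branch_at, concat_branch_at, hdc, hdc, hdc, hdc, hx']
        ring
    rw [hconcat, hconcat, hx'] at this
    have hh : β * (E y φ - u y - (E x₀ φ - u x₀)) = 0 := by
      simp only [E]
      linarith
    exact sub_eq_zero.1 ((mul_eq_zero.1 hh).resolve_left hβ.ne')
  let I₁ (φ : OneStepDomain S u β) : ℝ := (E x₀ φ - u x₀) / β
  have hEI (y : ProbabilityMeasure C) (φ : OneStepDomain S u β) : E y φ = u y + β * I₁ φ := by
    rw [mul_div_cancel₀ _ hβ.ne', ← hE y φ]
    ring
  -- Dynamic consistency, used in both directions, allows each continuation to be replaced by a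
  -- deterministic plan of the same value, which turns `h` into a branching plan.
  have hVeq {h g : Plan S C} (h0 : h.at' 0 = g.at' 0)
      (hs : ∀ s, V (h.cont s) = V (g.cont s)) : V h = V g := by
    let ω₀ : States S := fun _ => Classical.arbitrary S
    have hc (s : S) : V (h.cond s) = V (g.cond s) := by
      rw [cond_eq_concat h s ω₀, cond_eq_concat g s ω₀, hconcat, hconcat, h0, hs]
    exact hV.eq_of_indiff
      (hR.dynamically_consistent h g h0 fun s => (hV.represents _ _).2 (hc s).ge)
      (hR.dynamically_consistent g h h0.symm fun s => (hV.represents _ _).2 (hc s).le)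
  obtain ⟨x, y, hxy⟩ := hnc
  refine ⟨V, u, β, I₁, ⟨hV.represents, hu, ⟨hβ, hβ1⟩, ⟨?_, ?_, ?_⟩, ?_⟩, ha, ⟨x, y, hxy.ne⟩, ?_⟩
  · intro ξn ξ h
    refine Tendsto.div_const (Tendsto.sub_const ?_ _) _
    refine (hV.continuous.tendsto _).comp ?_
    rw [nhds_induced, tendsto_comap_iff]
    refine tendsto_pi_nhds.2 fun t => tendsto_pi_nhds.2 fun ω => ?_
    cases t with
    | zero => exact tendsto_const_nhds
    | succ t => exact ((((continuous_apply t).comp hV.continuous_path).tendsto _).comp (h (ω 0)))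
  · intro ξ ξ' h
    refine div_le_div_of_nonneg_right (sub_le_sub_right (hshift _ _ _ _ fun s => ?_) _) hβ.le
    have := mul_le_mul_of_nonneg_left (h s) hβ.le
    linarith
  · intro k hk ξ hξ
    have : E x₀ ξ = u x₀ + β * k := by
      simp only [E, hξ]
      rw [branch_const, hdc, hV.path k (hrange ▸ hk)]
    simp only [I₁, this]
    field_simp
    ring
  · intro h
    have hm (s : S) : V (h.cont s) ∈ Set.range (discounted u β) := hrange ▸ hV.mem_Icc _
    refine ⟨BFun.ofFinite (fun s => V (h.cont s)) hm, fun s => rfl, fun ω => ?_⟩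
    rw [← hEI]
    refine hVeq (funext fun ω' => h.at_zero _ _) fun s => ?_
    exact (hV.path _ (hV.mem_Icc _)).symm
  -- A small shift `k` of continuation values is offset by improving the first lottery from `x`
  -- towards `y` by `β k` utils.
  · have hsmall (ξ η : OneStepDomain S u β) (k : ℝ) (hk : 0 ≤ k) (hk1 : β * k ≤ u y - u x)
        (h : ∀ s, η s = ξ s + k) : I₁ η = I₁ ξ + k := by
      have hyx := sub_pos.2 hxy
      let a : unitInterval := ⟨β * k / (u y - u x), div_nonneg (mul_nonneg hβ.le hk) hyx.le,
        (div_le_one hyx).2 hk1⟩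
      have hua : u (mix a y x) = u x + β * k := by
        have e : β * k / (u y - u x) * (u y - u x) = β * k := div_mul_cancel₀ _ hyx.ne'
        rw [ha]
        change β * k / (u y - u x) * u y + (1 - β * k / (u y - u x)) * u x = _
        linear_combination e
      have : E x η = E (mix a y x) ξ := by
        apply le_antisymm <;> refine hshift _ _ _ _ fun s => le_of_eq ?_ <;>
        · rw [hua, h]
          ring
      rw [hEI, hEI, hua] at this
      have hh : β * (I₁ η - (I₁ ξ + k)) = 0 := by linarith
      exact sub_eq_zero.1 ((mul_eq_zero.1 hh).resolve_left hβ.ne')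
    -- A large shift is divided into `n + 1` equal ones; the intermediate function lies between `ξ`
    -- and `η`, hence stays in the domain.
    have hsteps (n : ℕ) : ∀ (ξ η : OneStepDomain S u β) (k : ℝ), 0 ≤ k →
        β * k ≤ n * (u y - u x) → (∀ s, η s = ξ s + k) → I₁ η = I₁ ξ + k := by
      induction n with
      | zero =>
        intro ξ η k hk hk1 h
        exact hsmall ξ η k hk (by push_cast at hk1; linarith) h
      | succ n ih =>
        intro ξ η k hk hk1 h
        have hn : (0 : ℝ) < n + 1 := by positivity
        push_cast at hk1
        have hj : k / (n + 1) * (n + 1) = k := div_mul_cancel₀ _ hn.ne'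
        have hj0 : 0 ≤ k / (n + 1) := div_nonneg hk hn.le
        have hjk : k / (n + 1) ≤ k := div_le_self hk (by linarith [n.cast_nonneg (α := ℝ)])
        have hβj : β * (k / (n + 1)) ≤ u y - u x := by
          rw [mul_div_assoc', div_le_iff₀ hn]
          linarith
        have hm (s : S) : ξ s + k / (n + 1) ∈ Set.range (discounted u β) :=
          hrange.ge ⟨by linarith [(hmem ξ s).1], by linarith [(hmem η s).2, h s]⟩
        let ζ : OneStepDomain S u β := BFun.ofFinite (fun s => ξ s + k / (n + 1)) hm
        have h1 := hsmall ξ ζ _ hj0 hβj fun s => rfl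
        have h2 := ih ζ η (k - k / (n + 1)) (by linarith)
          (by
            have : k - k / (n + 1) = n * (k / (n + 1)) := by linarith
            rw [this, mul_left_comm]
            exact mul_le_mul_of_nonneg_left hβj n.cast_nonneg)
          fun s => by
            rw [h s]
            change ξ s + k = ξ s + k / (n + 1) + _
            ring
        linarith
    intro ξ η k h
    rcases le_total 0 k with hk | hk
    · obtain ⟨n, hn⟩ := exists_nat_ge (β * k / (u y - u x))
      exact hsteps n ξ η k hk ((div_le_iff₀ (sub_pos.2 hxy)).1 hn) h
    · obtain ⟨n, hn⟩ := exists_nat_ge (β * -k / (u y - u x))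
      have := hsteps n η ξ (-k) (neg_nonneg.2 hk) ((div_le_iff₀ (sub_pos.2 hxy)).1 hn)
        fun s => by linarith [h s]
      linarith

end Recursion

end MonoRec
end

theorem theorem1 {S C : Type*} [Fintype S] (hS : 3 ≤ Fintype.card S)
    [TopologicalSpace C] [CompactSpace C] [TopologicalSpace.MetrizableSpace C] [Nontrivial C]
    [MeasurableSpace C] [BorelSpace C]
    (R : MonoRec.Plan S C → MonoRec.Plan S C → Prop) :
    (MonoRec.SatisfiesAxioms R ↔
      ∃ (V : MonoRec.Plan S C → ℝ) (u : ProbabilityMeasure C → ℝ) (β : ℝ)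
        (I₁ : MonoRec.OneStepDomain S u β → ℝ) (I₀ : MonoRec.ExAnteDomain S u β → ℝ),
        MonoRec.IsTwofoldRepresentation R V u β I₁ I₀) ∧
    (∀ (V : MonoRec.Plan S C → ℝ) (u : ProbabilityMeasure C → ℝ) (β : ℝ)
        (I₁ : MonoRec.OneStepDomain S u β → ℝ) (I₀ : MonoRec.ExAnteDomain S u β → ℝ),
        MonoRec.IsTwofoldRepresentation R V u β I₁ I₀ →
        (∀ (h : MonoRec.Plan S C) (ξ : MonoRec.ExAnteDomain S u β),
          MonoRec.IsLifetimeUtility ξ h →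
            (∃ k φ, MonoRec.IsTranslatedContinuation I₀ ξ k φ) ∧
              MonoRec.GeneralizedRectangularityAt I₁ I₀ ξ) ∧
        ∃ I₀' : MonoRec.ExAnteDomain S u β → ℝ,
          MonoRec.IsTwofoldRepresentation R V u β I₁ I₀' ∧
          (∀ (h : MonoRec.Plan S C) (ξ : MonoRec.ExAnteDomain S u β),
            MonoRec.IsLifetimeUtility ξ h → I₀' ξ = I₀ ξ) ∧
          ∀ ξ : MonoRec.ExAnteDomain S u β,
            MonoRec.GeneralizedRectangularityAt I₁ I₀' ξ) := by
  have hne : Nonempty S := Fintype.card_pos_iff.1 (by omega)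
  refine ⟨⟨fun hR => ?_, fun ⟨V, u, β, I₁, I₀, hR⟩ => hR.satisfiesAxioms⟩,
    fun V u β I₁ I₀ hR => ⟨fun h ξ hξ => hR.generalizedRectangularityAt hξ, ?_⟩⟩
  · obtain ⟨V, u, β, I₁, hrec, ha, hu, hT⟩ := hR.exists_recursive
    obtain ⟨A, N, hA, hAI⟩ := hrec.exists_aggregator ha hT (Classical.arbitrary S)
    exact ⟨V, u, β, I₁, _, hrec.isTwofold ha hu hT hA hAI⟩
  · obtain ⟨A, N, hA, hAI⟩ :=
      hR.recursive.exists_aggregator hR.affine_u hR.translation₁ (Classical.arbitrary S)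
    have hR' := hR.recursive.isTwofold hR.affine_u hR.nonconstant_u hR.translation₁ hA hAI
    -- The given and the constructed ex ante functional belong to the same `V`, which both compute
    -- on lifetime utilities.
    refine ⟨_, hR', fun h ξ hξ => ?_, fun ξ => ?_⟩
    · rw [hR.exAnte_eq hξ]
      exact hR'.exAnte_eq hξ
    · exact MonoRec.generalizedRectangularityAt_limAgg hR.recursive.discount.1
        hR.recursive.discount.2 hA hAI ξ
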